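/- For $k\ge1$ let $\log_k$ denote the $k$-fold iterated natural logarithm ($\log_1=\log$), and for $x$ sufficiently large put $B(x):=\frac{\sqrt{\log_2 x}}{\log_3 x\,(\log_4 x)^2}$. Let $\mu$ be the Möbius function and $\omega(n)$ the number of distinct prime factors of $n$. For real $y$ let $\omega_y(n)$ be the number of primes $p\mid n$ with $p\le y$, and set $\mu_y(n):=\mu^2(n)(-1)^{\omega_y(n)}$. For real $u$ set $\mu(n;u):=\mu^2(n)e^{iu\omega(n)}$. There is an absolute constant $x_0$ such that for every fixed integer $a\ge1$ the following hold, with sums over positive integers $n$ and with implied constants depending only on $a$. (a) For all real $x\ge x_0$ and $2\le y\le x$ such that $\beta:=\frac{\log x}{\log y}$ satisfies $\beta\le e^{B(x)}$, $$\Big|\sum_{n\le x}\mu_y(n)\mu_y(n+a)\Big|\ll_a x\left(\frac1{\log_2 y}+e^{-\frac1{21}\beta\log\beta}\right).$$ (b) For all real $x\ge x_0$ and all real $u,v$ with $|u|,|v|\le2\pi$, writing $w:=\max\{|u|,|v|\}$, $$\Big|\sum_{n\le x}\mu(n;u)\mu(n+a;v)\Big|\ll_a x\left(w\max\{1,\log(1/w)\}+(\log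 x)^{-\frac13(u^2+v^2)}\right),$$ where $w\max\{1,\log(1/w)\}$ is read as $0$ for $w=0$. (For $w\le w_0<1$ with $w_0$ fixed, $\max\{1,\log(1/w)\}$ may be replaced by $\log(1/w)$, the implied constant then depending also on $w_0$.) -/

import Mathlib

noncomputable section

namespace MoebiusCorrelation

/-- The `k`-fold iterated natural logarithm `log_k x`, with `log_1 x = log x`. -/
def iterLog (k : ℕ) (x : ℝ) : ℝ := Real.log^[k] x

/-- `B(x) = √(log_2 x) / (log_3 x · (log_4 x)²)`. -/
def B (x : ℝ) : ℝ :=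
  Real.sqrt (iterLog 2 x) / (iterLog 3 x * iterLog 4 x ^ 2)

/-- `ω_y(n)`: the number of primes `p ∣ n` with `p ≤ y`. -/
def omegaTrunc (y : ℝ) (n : ℕ) : ℕ :=
  (n.primeFactors.filter fun p : ℕ => (p : ℝ) ≤ y).card

/-- `μ_y(n) = μ²(n) (-1)^{ω_y(n)}`. -/
def muTrunc (y : ℝ) (n : ℕ) : ℤ :=
  ArithmeticFunction.moebius n ^ 2 * (-1) ^ omegaTrunc y n

/-- `μ(n; u) = μ²(n) e^{i u ω(n)}`, with `ω(n)` the number of distinct prime factors of `n`. -/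
def muTwist (u : ℝ) (n : ℕ) : ℂ :=
  ((ArithmeticFunction.moebius n ^ 2 : ℤ) : ℂ) *
    Complex.exp (Complex.I * (u : ℂ) * (ArithmeticFunction.cardDistinctFactors n : ℂ))

end MoebiusCorrelation

end

noncomputable section

namespace MoebiusCorrelation

open Finset

lemma sum_range_mul_of_periodic {F : ℕ → ℂ} {D : ℕ} (hF : Function.Periodic F D) (k : ℕ) :
    ∑ n ∈ range (D * k), F n = k * ∑ n ∈ range D, F n := by
  induction k with
  | zero => simp
  | succ k ih =>
    rw [Nat.mul_succ, sum_range_add, ih]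
    have : ∀ n, F (D * k + n) = F n := by
      intro n
      have := (hF.nsmul k) n
      rw [← this]
      congr 1
      simp [mul_comm, add_comm]
    simp only [this]
    push_cast
    ring

lemma norm_sum_range_sub_le_of_periodic {F : ℕ → ℂ} {D : ℕ} (hD : 0 < D)
    (hF : Function.Periodic F D) (N : ℕ) :
    ‖∑ n ∈ range N, F n - (N / D : ℂ) * ∑ n ∈ range D, F n‖ ≤ 2 * ∑ n ∈ range D, ‖F n‖ := by
  have hD' : (D : ℂ) ≠ 0 := by exact_mod_cast hD.ne'
  set r := N % D with hr
  have hrD : r < D := Nat.mod_lt _ hD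
  have hN : N = D * (N / D) + r := (Nat.div_add_mod N D).symm
  have hsum : ∑ n ∈ range N, F n
      = (N / D : ℕ) * ∑ n ∈ range D, F n + ∑ n ∈ range r, F n := by
    conv_lhs => rw [hN]
    rw [sum_range_add, sum_range_mul_of_periodic hF]
    congr 1
    refine sum_congr rfl fun n _ => ?_
    have := (hF.nsmul (N / D)) n
    rw [← this]
    congr 1
    simp [mul_comm, add_comm]
  have hNc : (N : ℂ) = D * (N / D : ℕ) + r := by exact_mod_cast hN
  have hkey : ∑ n ∈ range N, F n - (N / D : ℂ) * ∑ n ∈ range D, F n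
      = ∑ n ∈ range r, F n - (r / D : ℂ) * ∑ n ∈ range D, F n := by
    rw [hsum, hNc]
    field_simp
    ring
  rw [hkey]
  have h1 : ‖∑ n ∈ range r, F n‖ ≤ ∑ n ∈ range D, ‖F n‖ :=
    (norm_sum_le _ _).trans
      (sum_le_sum_of_subset_of_nonneg (range_mono hrD.le) fun _ _ _ => norm_nonneg _)
  have h2 : ‖(r / D : ℂ) * ∑ n ∈ range D, F n‖ ≤ ∑ n ∈ range D, ‖F n‖ := by
    rw [norm_mul]
    have : ‖(r / D : ℂ)‖ ≤ 1 := by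
      rw [norm_div, Complex.norm_natCast, Complex.norm_natCast]
      apply div_le_one_of_le₀ _ (Nat.cast_nonneg _)
      exact_mod_cast hrD.le
    calc _ ≤ 1 * ‖∑ n ∈ range D, F n‖ := by gcongr
      _ ≤ _ := by rw [one_mul]; exact norm_sum_le _ _
  calc _ ≤ _ := norm_sub_le _ _
    _ ≤ _ := by linarith

lemma sum_range_mul_of_coprime {R : Type*} [CommSemiring R] {F G : ℕ → R} {a b : ℕ} (ha : 0 < a) (hb : 0 < b)
    (hab : a.Coprime b) (hF : Function.Periodic F a) (hG : Function.Periodic G b) :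
    ∑ n ∈ range (a * b), F n * G n = (∑ n ∈ range a, F n) * ∑ n ∈ range b, G n := by
  rw [sum_mul_sum, ← sum_product']
  refine sum_nbij' (fun n => (n % a, n % b)) (fun p => Nat.chineseRemainder hab p.1 p.2)
    ?_ ?_ ?_ ?_ ?_
  · intro n _
    simp [Nat.mod_lt _ ha, Nat.mod_lt _ hb]
  · intro p _
    simpa using Nat.chineseRemainder_lt_mul hab p.1 p.2 ha.ne' hb.ne'
  · intro n hn
    have hn : n < a * b := by simpa using hn
    have h := Nat.chineseRemainder_modEq_unique hab (a := n % a) (b := n % b) (z := n)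
      (Nat.mod_modEq _ _).symm (Nat.mod_modEq _ _).symm
    have h2 := Nat.chineseRemainder_lt_mul hab (n % a) (n % b) ha.ne' hb.ne'
    exact (Nat.ModEq.eq_of_lt_of_lt h hn h2).symm
  · rintro ⟨p, q⟩ hp
    simp only [mem_product, mem_range] at hp
    have h := (Nat.chineseRemainder hab p q).2
    ext
    · exact (show _ % a = p % a from h.1).trans (Nat.mod_eq_of_lt hp.1)
    · exact (show _ % b = q % b from h.2).trans (Nat.mod_eq_of_lt hp.2)
  · intro n _
    simp [hF.map_mod_nat n, hG.map_mod_nat n]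

lemma periodic_mul_right {R : Type*} {F : ℕ → R} {a : ℕ} (hF : Function.Periodic F a) (b : ℕ) :
    Function.Periodic F (a * b) := by
  have := hF.nsmul b
  rwa [smul_eq_mul, mul_comm] at this

lemma periodic_prod {R : Type*} [CommSemiring R] {t : ℕ → ℕ → R} (s : Finset ℕ)
    (ht : ∀ p ∈ s, Function.Periodic (t p) p) :
    Function.Periodic (fun n => ∏ p ∈ s, t p n) (∏ p ∈ s, p) := by
  intro n
  refine prod_congr rfl fun p hp => ?_
  obtain ⟨c, hc⟩ := dvd_prod_of_mem (fun p => p) hp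
  rw [hc]
  exact periodic_mul_right (ht p hp) c n

lemma sum_range_prod_of_coprime {R : Type*} [CommSemiring R] {h : ℕ → R} {t : ℕ → ℕ → R} {Q : ℕ} (hQ : 0 < Q)
    (hh : Function.Periodic h Q) (s : Finset ℕ) (hs : ∀ p ∈ s, p.Prime ∧ Q.Coprime p)
    (ht : ∀ p ∈ s, Function.Periodic (t p) p) :
    ∑ n ∈ range (Q * ∏ p ∈ s, p), h n * ∏ p ∈ s, t p n
      = (∑ n ∈ range Q, h n) * ∏ p ∈ s, ∑ n ∈ range p, t p n := by
  induction s using Finset.induction_on with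
  | empty => simp
  | insert a s ha ih =>
    have hs' : ∀ p ∈ s, p.Prime ∧ Q.Coprime p := fun p hp => hs p (mem_insert_of_mem hp)
    have ht' : ∀ p ∈ s, Function.Periodic (t p) p := fun p hp => ht p (mem_insert_of_mem hp)
    have haP := hs a (mem_insert_self _ _)
    rw [prod_insert ha, prod_insert ha]
    have hcop : (Q * ∏ p ∈ s, p).Coprime a := by
      refine Nat.Coprime.mul_left haP.2 (Nat.Coprime.prod_left fun p hp => ?_)
      exact (Nat.coprime_primes (hs' p hp).1 haP.1).2 (by rintro rfl; exact ha hp)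
    have hpos : 0 < Q * ∏ p ∈ s, p := Nat.mul_pos hQ (prod_pos fun p hp => (hs' p hp).1.pos)
    have hper : Function.Periodic (fun n => h n * ∏ p ∈ s, t p n) (Q * ∏ p ∈ s, p) := by
      intro n
      have h1 := periodic_mul_right hh (∏ p ∈ s, p) n
      have h2 := periodic_mul_right (periodic_prod s ht') Q n
      beta_reduce at h2
      rw [mul_comm _ Q] at h2
      simp only [h1, h2]
    have := sum_range_mul_of_coprime hpos haP.1.pos hcop hper (ht a (mem_insert_self _ _))
    rw [ih hs' ht'] at this
    rw [mul_comm a, ← mul_assoc, mul_comm (∑ n ∈ range a, t a n), ← mul_assoc, ← this]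
    refine sum_congr rfl fun n _ => ?_
    rw [prod_insert ha]
    ring

lemma norm_sum_mul_prod_sub_le {h : ℕ → ℂ} {t : ℕ → ℕ → ℂ} {Q : ℕ} (hQ : 0 < Q)
    (hh : Function.Periodic h Q) (h1 : ∀ n, ‖h n‖ ≤ 1) (s : Finset ℕ)
    (hs : ∀ p ∈ s, p.Prime ∧ Q.Coprime p)
    (ht : ∀ p ∈ s, Function.Periodic (t p) p) (h4 : ∀ p ∈ s, ∑ n ∈ range p, ‖t p n‖ ≤ 4) (N : ℕ) :
    ‖∑ n ∈ range N, h n * ∏ p ∈ s, t p n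
        - N * ((∑ n ∈ range Q, h n) / Q) * ∏ p ∈ s, ((∑ n ∈ range p, t p n) / p)‖
      ≤ 2 * Q * 4 ^ #s := by
  have hpos : 0 < Q * ∏ p ∈ s, p := Nat.mul_pos hQ (prod_pos fun p hp => (hs p hp).1.pos)
  have hper : Function.Periodic (fun n => h n * ∏ p ∈ s, t p n) (Q * ∏ p ∈ s, p) := by
    intro n
    have h1 := periodic_mul_right hh (∏ p ∈ s, p) n
    have h2 := periodic_mul_right (periodic_prod s ht) Q n
    beta_reduce at h2
    rw [mul_comm _ Q] at h2
    simp only [h1, h2]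
  have key := norm_sum_range_sub_le_of_periodic hpos hper N
  have e1 := sum_range_prod_of_coprime hQ hh s hs ht
  have e2 := sum_range_prod_of_coprime (h := fun n => ‖h n‖) (t := fun p n => ‖t p n‖) hQ
    (fun n => by simp only [hh n]) s hs (fun p hp n => by simp only [ht p hp n])
  simp only [norm_mul, norm_prod] at key
  rw [e1, e2] at key
  have e3 : (N / (Q * ∏ p ∈ s, p : ℕ) : ℂ) * ((∑ n ∈ range Q, h n) * ∏ p ∈ s, ∑ n ∈ range p, t p n)
      = N * ((∑ n ∈ range Q, h n) / Q) * ∏ p ∈ s, ((∑ n ∈ range p, t p n) / p) := by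
    rw [prod_div_distrib]
    push_cast
    simp only [div_eq_mul_inv, mul_inv]
    ring
  rw [e3] at key
  refine key.trans ?_
  have h5 : ∑ n ∈ range Q, ‖h n‖ ≤ Q := by
    calc _ ≤ ∑ n ∈ range Q, (1 : ℝ) := sum_le_sum fun n _ => h1 n
      _ = _ := by simp
  have h6 : ∏ p ∈ s, ∑ n ∈ range p, ‖t p n‖ ≤ 4 ^ #s := by
    rw [← prod_const]
    exact prod_le_prod (fun p _ => sum_nonneg fun _ _ => norm_nonneg _) h4
  have h7 : 0 ≤ ∏ p ∈ s, ∑ n ∈ range p, ‖t p n‖ :=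
    prod_nonneg fun p _ => sum_nonneg fun _ _ => norm_nonneg _
  rw [mul_assoc]
  gcongr

/-- The elementary symmetric sum of degree `k` of the values of `c` on `s`. -/
def elemSymm {R : Type*} [CommSemiring R] (c : ℕ → R) (k : ℕ) (s : Finset ℕ) : R :=
  ∑ S ∈ s.powerset with #S = k, ∏ p ∈ S, c p

/-- The expansion of `∏ p ∈ s, (1 + t p)`, cut at degree `k`. -/
def truncProd {R : Type*} [CommSemiring R] (t : ℕ → R) (k : ℕ) (s : Finset ℕ) : R :=
  ∑ S ∈ s.powerset with #S ≤ k, ∏ p ∈ S, t p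

section Symm

variable {R : Type*} [CommSemiring R]

lemma elemSymm_zero (c : ℕ → R) (s : Finset ℕ) : elemSymm c 0 s = 1 := by
  have : s.powerset.filter (fun S => #S = 0) = {∅} := by
    ext S; simp +contextual [card_eq_zero]
  rw [elemSymm, this]; simp

lemma elemSymm_succ_empty (c : ℕ → R) (k : ℕ) : elemSymm c (k + 1) ∅ = 0 := by
  simp [elemSymm, sum_filter]

lemma truncProd_zero (c : ℕ → R) (s : Finset ℕ) : truncProd c 0 s = 1 := by
  have : s.powerset.filter (fun S => #S ≤ 0) = {∅} := by
    ext S; simp +contextual [card_eq_zero]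
  rw [truncProd, this]; simp

lemma truncProd_empty (c : ℕ → R) (k : ℕ) : truncProd c k ∅ = 1 := by
  simp [truncProd, sum_filter]

lemma elemSymm_succ_insert (c : ℕ → R) (k : ℕ) {a : ℕ} {s : Finset ℕ} (ha : a ∉ s) :
    elemSymm c (k + 1) (insert a s) = elemSymm c (k + 1) s + c a * elemSymm c k s := by
  simp only [elemSymm, sum_filter]
  rw [sum_powerset_insert ha, mul_sum]
  congr 1
  refine sum_congr rfl fun S hS => ?_
  have : a ∉ S := fun h => ha (mem_powerset.1 hS h)
  rw [card_insert_of_notMem this, prod_insert this]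
  simp only [Nat.add_right_cancel_iff, mul_ite, mul_zero]

lemma truncProd_succ_insert (c : ℕ → R) (k : ℕ) {a : ℕ} {s : Finset ℕ} (ha : a ∉ s) :
    truncProd c (k + 1) (insert a s) = truncProd c (k + 1) s + c a * truncProd c k s := by
  simp only [truncProd, sum_filter]
  rw [sum_powerset_insert ha, mul_sum]
  congr 1
  refine sum_congr rfl fun S hS => ?_
  have : a ∉ S := fun h => ha (mem_powerset.1 hS h)
  rw [card_insert_of_notMem this, prod_insert this]
  simp only [Nat.add_le_add_iff_right, mul_ite, mul_zero]

end Symm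

lemma elemSymm_nonneg {c : ℕ → ℝ} (hc : ∀ p, 0 ≤ c p) (k : ℕ) (s : Finset ℕ) :
    0 ≤ elemSymm c k s :=
  sum_nonneg fun _ _ => prod_nonneg fun p _ => hc p

lemma elemSymm_mono {c d : ℕ → ℝ} (hc : ∀ p, 0 ≤ c p) (k : ℕ) {s : Finset ℕ}
    (h : ∀ p ∈ s, c p ≤ d p) : elemSymm c k s ≤ elemSymm d k s := by
  refine sum_le_sum fun S hS => prod_le_prod (fun p _ => hc p) fun p hp => h p ?_
  exact mem_powerset.1 (mem_filter.1 hS).1 hp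

lemma pow_succ_add_le_add_pow {σ c : ℝ} (hσ : 0 ≤ σ) (hc : 0 ≤ c) (k : ℕ) :
    σ ^ (k + 1) + (k + 1) * (c * σ ^ k) ≤ (σ + c) ^ (k + 1) := by
  induction k with
  | zero => simp
  | succ k ih =>
    have h2 : 0 ≤ c * c * σ ^ k := by positivity
    calc _ ≤ (σ + c) * (σ ^ (k + 1) + (k + 1) * (c * σ ^ k)) := by
          push_cast
          have : 0 ≤ (k + 1) * (c * c * σ ^ k) := by positivity
          ring_nf at this ⊢
          linarith
      _ ≤ (σ + c) * (σ + c) ^ (k + 1) := by gcongr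
      _ = _ := by ring

lemma elemSymm_le_pow_div_factorial {c : ℕ → ℝ} (hc : ∀ p, 0 ≤ c p) (s : Finset ℕ) (k : ℕ) :
    elemSymm c k s ≤ (∑ p ∈ s, c p) ^ k / k.factorial := by
  induction s using Finset.induction_on generalizing k with
  | empty =>
    cases k with
    | zero => simp [elemSymm_zero]
    | succ k => simp [elemSymm_succ_empty]
  | insert a s ha ih =>
    cases k with
    | zero => simp [elemSymm_zero]
    | succ k =>
      rw [elemSymm_succ_insert _ _ ha, sum_insert ha]
      have h1 := ih (k + 1)
      have h2 := ih k
      have hσ : 0 ≤ ∑ p ∈ s, c p := sum_nonneg fun p _ => hc p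
      have h3 := pow_succ_add_le_add_pow hσ (hc a) k
      have hk : (0 : ℝ) < k.factorial := by exact_mod_cast k.factorial_pos
      calc _ ≤ (∑ p ∈ s, c p) ^ (k + 1) / (k + 1).factorial
              + c a * ((∑ p ∈ s, c p) ^ k / k.factorial) := by
            gcongr; exact hc a
        _ = ((∑ p ∈ s, c p) ^ (k + 1) + (k + 1) * (c a * (∑ p ∈ s, c p) ^ k))
              / (k + 1).factorial := by
            rw [Nat.factorial_succ]; push_cast; field_simp
        _ ≤ _ := by rw [add_comm (c a)]; gcongr

lemma norm_prod_one_add_le_one {t : ℕ → ℂ} {s : Finset ℕ} (h1 : ∀ p ∈ s, ‖1 + t p‖ ≤ 1) :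
    ‖∏ p ∈ s, (1 + t p)‖ ≤ 1 := by
  rw [norm_prod]
  exact prod_le_one (fun _ _ => norm_nonneg _) h1

lemma norm_prod_sub_truncProd_le {t : ℕ → ℂ} (s : Finset ℕ) (h1 : ∀ p ∈ s, ‖1 + t p‖ ≤ 1)
    (k : ℕ) : ‖∏ p ∈ s, (1 + t p) - truncProd t k s‖ ≤ elemSymm (fun p => ‖t p‖) (k + 1) s := by
  induction s using Finset.induction_on generalizing k with
  | empty => simp [truncProd_empty, elemSymm_succ_empty]
  | insert a s ha ih =>
    have h1' : ∀ p ∈ s, ‖1 + t p‖ ≤ 1 := fun p hp => h1 p (mem_insert_of_mem hp)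
    rw [prod_insert ha, elemSymm_succ_insert _ _ ha]
    cases k with
    | zero =>
      rw [truncProd_zero, elemSymm_zero]
      have h2 := ih h1' 0
      rw [truncProd_zero] at h2
      calc _ = ‖(∏ p ∈ s, (1 + t p) - 1) + t a * ∏ p ∈ s, (1 + t p)‖ := by congr 1; ring
        _ ≤ ‖∏ p ∈ s, (1 + t p) - 1‖ + ‖t a‖ * ‖∏ p ∈ s, (1 + t p)‖ := by
          rw [← norm_mul]; exact norm_add_le _ _
        _ ≤ _ := by
          gcongr
          exact norm_prod_one_add_le_one h1'
    | succ k =>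
      rw [truncProd_succ_insert _ _ ha]
      calc _ = ‖(∏ p ∈ s, (1 + t p) - truncProd t (k + 1) s)
            + t a * (∏ p ∈ s, (1 + t p) - truncProd t k s)‖ := by congr 1; ring
        _ ≤ ‖∏ p ∈ s, (1 + t p) - truncProd t (k + 1) s‖
            + ‖t a‖ * ‖∏ p ∈ s, (1 + t p) - truncProd t k s‖ := by
          rw [← norm_mul]; exact norm_add_le _ _
        _ ≤ _ := by
          gcongr
          · exact ih h1' (k + 1)
          · exact ih h1' k

lemma truncProd_const_le {x : ℝ} (hx : 0 ≤ x) (s : Finset ℕ) (k : ℕ) :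
    truncProd (fun _ => x) k s ≤ (1 + x * #s) ^ k := by
  induction s using Finset.induction_on generalizing k with
  | empty => simp [truncProd_empty]
  | insert a s ha ih =>
    cases k with
    | zero => simp [truncProd_zero]
    | succ k =>
      rw [truncProd_succ_insert _ _ ha, card_insert_of_notMem ha]
      have h0 : 0 ≤ 1 + x * #s := by positivity
      push_cast
      calc _ ≤ (1 + x * #s) ^ (k + 1) + x * (1 + x * #s) ^ k := by
            gcongr
            · exact ih (k + 1)
            · exact ih k
        _ = (1 + x * (#s + 1)) * (1 + x * #s) ^ k := by ring
        _ ≤ (1 + x * (#s + 1)) * (1 + x * (#s + 1)) ^ k := by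
            gcongr; linarith
        _ = _ := by ring

lemma norm_prod_sub_prod_le {ι : Type*} (s : Finset ι) (H T : ι → ℂ) (G : ι → ℝ)
    (hH : ∀ i ∈ s, ‖H i‖ ≤ 1) (hT : ∀ i ∈ s, ‖H i - T i‖ ≤ G i) :
    ‖∏ i ∈ s, H i - ∏ i ∈ s, T i‖ ≤ ∏ i ∈ s, (1 + G i) - 1 := by
  classical
  induction s using Finset.induction_on with
  | empty => simp
  | insert a s ha ih =>
    have hH' : ∀ i ∈ s, ‖H i‖ ≤ 1 := fun p hp => hH p (mem_insert_of_mem hp)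
    have hT' : ∀ i ∈ s, ‖H i - T i‖ ≤ G i := fun p hp => hT p (mem_insert_of_mem hp)
    have hG : 0 ≤ G a := (norm_nonneg _).trans (hT a (mem_insert_self _ _))
    rw [prod_insert ha, prod_insert ha, prod_insert ha]
    have hTs : ‖∏ i ∈ s, T i‖ ≤ ∏ i ∈ s, (1 + G i) := by
      rw [norm_prod]
      refine prod_le_prod (fun _ _ => norm_nonneg _) fun i hi => ?_
      calc ‖T i‖ = ‖H i - (H i - T i)‖ := by congr 1; ring
        _ ≤ _ := (norm_sub_le _ _).trans (add_le_add (hH' i hi) (hT' i hi))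
    calc _ = ‖H a * (∏ i ∈ s, H i - ∏ i ∈ s, T i) + (H a - T a) * ∏ i ∈ s, T i‖ := by
          congr 1; ring
      _ ≤ ‖H a‖ * ‖∏ i ∈ s, H i - ∏ i ∈ s, T i‖ + ‖H a - T a‖ * ‖∏ i ∈ s, T i‖ := by
          rw [← norm_mul, ← norm_mul]; exact norm_add_le _ _
      _ ≤ 1 * (∏ i ∈ s, (1 + G i) - 1) + G a * ∏ i ∈ s, (1 + G i) := by
          gcongr
          · exact hH a (mem_insert_self _ _)
          · exact ih hH' hT'
          · exact hT a (mem_insert_self _ _)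
      _ = _ := by ring

/-- Products over pairwise disjoint blocks of primes of sums over families of subsets are, on
average, products of local means. -/
lemma norm_sum_mul_prod_families_sub_le {J : ℕ} {h : ℕ → ℂ} {t : ℕ → ℕ → ℂ} {Q : ℕ} (hQ : 0 < Q)
    (hh : Function.Periodic h Q) (h1 : ∀ n, ‖h n‖ ≤ 1) (P : Fin J → Finset ℕ)
    (hdisj : Pairwise fun i j => Disjoint (P i) (P j))
    (hP : ∀ j, ∀ p ∈ P j, p.Prime ∧ Q.Coprime p)
    (ht : ∀ j, ∀ p ∈ P j, Function.Periodic (t p) p)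
    (h4 : ∀ j, ∀ p ∈ P j, ∑ n ∈ range p, ‖t p n‖ ≤ 4)
    (F : Fin J → Finset (Finset ℕ)) (hF : ∀ j, ∀ S ∈ F j, S ⊆ P j) (N : ℕ) :
    ‖∑ n ∈ range N, h n * ∏ j, ∑ S ∈ F j, ∏ p ∈ S, t p n
        - N * ((∑ n ∈ range Q, h n) / Q) *
          ∏ j, ∑ S ∈ F j, ∏ p ∈ S, ((∑ n ∈ range p, t p n) / p)‖
      ≤ 2 * Q * ∏ j, ∑ S ∈ F j, 4 ^ #S := by
  simp only [prod_univ_sum, mul_sum]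
  rw [sum_comm, ← sum_sub_distrib]
  refine (norm_sum_le _ _).trans (sum_le_sum fun σ hσ => ?_)
  have hσ' : ∀ j, σ j ∈ F j := Fintype.mem_piFinset.1 hσ
  have hsub : ∀ j, σ j ⊆ P j := fun j => hF j _ (hσ' j)
  have hd : Set.PairwiseDisjoint (↑(univ : Finset (Fin J))) σ := fun i _ j _ hij =>
    (hdisj hij).mono (hsub i) (hsub j)
  have hmem : ∀ p ∈ univ.biUnion σ, ∃ j, p ∈ P j := by
    intro p hp
    obtain ⟨j, _, hj⟩ := mem_biUnion.1 hp
    exact ⟨j, hsub j hj⟩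
  have key := norm_sum_mul_prod_sub_le hQ hh h1 (univ.biUnion σ)
    (fun p hp => by obtain ⟨j, hj⟩ := hmem p hp; exact hP j p hj)
    (fun p hp => by obtain ⟨j, hj⟩ := hmem p hp; exact ht j p hj)
    (fun p hp => by obtain ⟨j, hj⟩ := hmem p hp; exact h4 j p hj) N
  simp only [prod_biUnion hd, card_biUnion hd] at key
  rw [prod_pow_eq_pow_sum]
  exact key

lemma truncProd_eq_sum {R : Type*} [CommSemiring R] (t : ℕ → R) (k : ℕ) (s : Finset ℕ) :
    truncProd t k s = ∑ S ∈ s.powerset with #S ≤ k, ∏ p ∈ S, t p := rfl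

lemma one_add_elemSymm_eq_sum {R : Type*} [CommSemiring R] (t : ℕ → R) (k : ℕ) (s : Finset ℕ) :
    1 + elemSymm t (k + 1) s = ∑ S ∈ s.powerset with (#S = 0 ∨ #S = k + 1), ∏ p ∈ S, t p := by
  rw [filter_or, sum_union, ← elemSymm, elemSymm_zero, ← elemSymm]
  rw [disjoint_filter]
  intro S _ h
  omega

lemma sum_prod_one_add_elemSymm_le {J : ℕ} {t : ℕ → ℕ → ℂ} (P : Fin J → Finset ℕ)
    (hdisj : Pairwise fun i j => Disjoint (P i) (P j)) (hP : ∀ j, ∀ p ∈ P j, p.Prime)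
    (ht : ∀ j, ∀ p ∈ P j, Function.Periodic (t p) p)
    (h4 : ∀ j, ∀ p ∈ P j, ∑ n ∈ range p, ‖t p n‖ ≤ 4) (k : Fin J → ℕ) (N : ℕ) :
    ∑ n ∈ range N, ∏ j, (1 + elemSymm (fun p => ‖t p n‖) (k j + 1) (P j))
      ≤ N * ∏ j, (1 + elemSymm (fun p : ℕ => 4 / (p : ℝ)) (k j + 1) (P j))
        + 2 * ∏ j, (1 + 4 * (#(P j) : ℝ)) ^ (k j + 1) := by
  have herr := norm_sum_mul_prod_families_sub_le (h := fun _ => 1) (t := fun p n => (‖t p n‖ : ℂ))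
    one_pos (fun _ => rfl) (by simp) P hdisj (fun j p hp => ⟨hP j p hp, by simp⟩)
    (fun j p hp n => by simp only [ht j p hp n]) (fun j p hp => by simpa using h4 j p hp)
    (fun j => (P j).powerset.filter fun S => (#S = 0 ∨ #S = k j + 1))
    (fun j S hS => mem_powerset.1 (mem_filter.1 hS).1) N
  simp only [← one_add_elemSymm_eq_sum] at herr
  have hrem : ∀ j, truncProd (fun _ => (4 : ℝ)) (k j + 1) (P j)
      ≤ (1 + 4 * (#(P j) : ℝ)) ^ (k j + 1) := fun j =>
    truncProd_const_le (by norm_num) (P j) (k j + 1)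
  have hr2 : ∏ j, ∑ S ∈ (P j).powerset with (#S = 0 ∨ #S = k j + 1), (4 : ℝ) ^ #S
      ≤ ∏ j, (1 + 4 * (#(P j) : ℝ)) ^ (k j + 1) := by
    refine prod_le_prod (fun j _ => sum_nonneg fun _ _ => by positivity) fun j _ => ?_
    refine le_trans ?_ (hrem j)
    simp only [truncProd, prod_const]
    refine sum_le_sum_of_subset_of_nonneg (fun S hS => ?_) fun _ _ _ => by positivity
    simp only [mem_filter] at hS ⊢
    exact ⟨hS.1, by omega⟩
  set A := ∑ n ∈ range N, ∏ j, (1 + elemSymm (fun p => ‖t p n‖) (k j + 1) (P j)) with hA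
  set M : ℝ := N * ∏ j, (1 + elemSymm (fun p => (∑ n ∈ range p, ‖t p n‖) / p) (k j + 1) (P j))
    with hM
  have hAM : ((A - M : ℝ) : ℂ) = ∑ n ∈ range N, 1 * ∏ j, (1 + elemSymm (fun p => (‖t p n‖ : ℂ)) (k j + 1) (P j))
      - N * ((∑ n ∈ range 1, 1) / (1 : ℕ)) *
        ∏ j, (1 + elemSymm (fun p => (∑ n ∈ range p, (‖t p n‖ : ℂ)) / p) (k j + 1) (P j)) := by
    simp only [hA, hM, elemSymm]
    push_cast
    simp
  have e : A - M ≤ 2 * ∏ j, (1 + 4 * (#(P j) : ℝ)) ^ (k j + 1) := by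
    rw [← hAM, Complex.norm_real] at herr
    have := (Real.le_norm_self _).trans herr
    push_cast at this
    linarith
  have hmean : ∀ p : ℕ, 0 ≤ (∑ n ∈ range p, ‖t p n‖) / (p : ℝ) := fun p =>
    div_nonneg (sum_nonneg fun _ _ => norm_nonneg _) (Nat.cast_nonneg _)
  have hME : M ≤ N * ∏ j, (1 + elemSymm (fun p : ℕ => 4 / (p : ℝ)) (k j + 1) (P j)) := by
    rw [hM]
    refine mul_le_mul_of_nonneg_left (prod_le_prod (fun j _ => ?_) fun j _ => ?_)
      (Nat.cast_nonneg _)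
    · exact add_nonneg zero_le_one (elemSymm_nonneg hmean _ _)
    · refine (add_le_add_iff_left _).2 (elemSymm_mono hmean _ fun p hp => ?_)
      gcongr
      exact h4 j p hp
  linarith

theorem norm_sum_mul_prod_blocks_le {J : ℕ} {h : ℕ → ℂ} {t : ℕ → ℕ → ℂ} {Q : ℕ} (hQ : 0 < Q)
    (hh : Function.Periodic h Q) (h1 : ∀ n, ‖h n‖ ≤ 1) (P : Fin J → Finset ℕ)
    (hdisj : Pairwise fun i j => Disjoint (P i) (P j))
    (hP : ∀ j, ∀ p ∈ P j, p.Prime ∧ Q.Coprime p)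
    (ht : ∀ j, ∀ p ∈ P j, Function.Periodic (t p) p)
    (h4 : ∀ j, ∀ p ∈ P j, ∑ n ∈ range p, ‖t p n‖ ≤ 4)
    (ht1 : ∀ j, ∀ p ∈ P j, ∀ n, ‖1 + t p n‖ ≤ 1) (k : Fin J → ℕ) (N : ℕ) :
    ‖∑ n ∈ range N, h n * ∏ j, ∏ p ∈ P j, (1 + t p n)‖
      ≤ N * (∏ j, ∏ p ∈ P j, ‖1 + (∑ n ∈ range p, t p n) / p‖
          + 2 * (∏ j, (1 + elemSymm (fun p : ℕ => 4 / (p : ℝ)) (k j + 1) (P j)) - 1))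
        + 4 * Q * ∏ j, (1 + 4 * (#(P j) : ℝ)) ^ (k j + 1) := by
  set τ : ℕ → ℂ := fun p => (∑ n ∈ range p, t p n) / p with hτ
  set E : Fin J → ℝ := fun j => elemSymm (fun p : ℕ => 4 / (p : ℝ)) (k j + 1) (P j) with hE
  have hc0 : ∀ p : ℕ, 0 ≤ 4 / (p : ℝ) := fun p => by positivity
  have hQ1 : (1 : ℝ) ≤ Q := by exact_mod_cast hQ
  have hrem : ∀ j, truncProd (fun _ => (4 : ℝ)) (k j + 1) (P j)
      ≤ (1 + 4 * (#(P j) : ℝ)) ^ (k j + 1) := fun j =>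
    truncProd_const_le (by norm_num) (P j) (k j + 1)
  have hτ1 : ∀ j, ∀ p ∈ P j, ‖1 + τ p‖ ≤ 1 := by
    intro j p hp
    have hp0 : (0 : ℝ) < p := by exact_mod_cast (hP j p hp).1.pos
    have hp0' : (p : ℂ) ≠ 0 := by exact_mod_cast (hP j p hp).1.pos.ne'
    have : 1 + τ p = (∑ n ∈ range p, (1 + t p n)) / p := by
      rw [sum_add_distrib]
      simp [hτ]
      field_simp
    rw [this, norm_div, Complex.norm_natCast, div_le_one hp0]
    calc _ ≤ ∑ n ∈ range p, (1 : ℝ) := norm_sum_le_of_le _ fun n _ => ht1 j p hp n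
      _ = p := by simp
  have hτ4 : ∀ j, ∀ p ∈ P j, ‖τ p‖ ≤ 4 / p := by
    intro j p hp
    simp only [hτ]
    rw [norm_div, Complex.norm_natCast]
    gcongr
    exact (norm_sum_le _ _).trans (h4 j p hp)
  have hmain := norm_sum_mul_prod_families_sub_le hQ hh h1 P hdisj hP ht h4
    (fun j => (P j).powerset.filter fun S => #S ≤ k j)
    (fun j S hS => mem_powerset.1 (mem_filter.1 hS).1) N
  simp only [← truncProd_eq_sum] at hmain
  have hr1 : ∏ j, ∑ S ∈ (P j).powerset with #S ≤ k j, (4 : ℝ) ^ #S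
      ≤ ∏ j, (1 + 4 * (#(P j) : ℝ)) ^ (k j + 1) := by
    refine prod_le_prod (fun j _ => sum_nonneg fun _ _ => by positivity) fun j _ => ?_
    refine le_trans ?_ (hrem j)
    simp only [truncProd, prod_const]
    refine sum_le_sum_of_subset_of_nonneg (fun S hS => ?_) fun _ _ _ => by positivity
    simp only [mem_filter] at hS ⊢
    exact ⟨hS.1, hS.2.trans (Nat.le_succ _)⟩
  set R : ℝ := ∏ j, (1 + 4 * (#(P j) : ℝ)) ^ (k j + 1) with hR
  have hR0 : 0 ≤ R := prod_nonneg fun j _ => by positivity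
  -- the truncated main term
  have hT : ‖∏ j, truncProd τ (k j) (P j)‖
      ≤ ∏ j, ∏ p ∈ P j, ‖1 + τ p‖ + (∏ j, (1 + E j) - 1) := by
    have := norm_prod_sub_prod_le univ (fun j => ∏ p ∈ P j, (1 + τ p))
      (fun j => truncProd τ (k j) (P j)) E (fun j _ => norm_prod_one_add_le_one (hτ1 j))
      (fun j _ => (norm_prod_sub_truncProd_le (P j) (hτ1 j) (k j)).trans
        (elemSymm_mono (fun _ => norm_nonneg _) _ (hτ4 j)))
    have h2 := norm_sub_norm_le (∏ j, truncProd τ (k j) (P j)) (∏ j, ∏ p ∈ P j, (1 + τ p))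
    rw [norm_sub_rev] at h2
    have h3 : ‖∏ j, ∏ p ∈ P j, (1 + τ p)‖ = ∏ j, ∏ p ∈ P j, ‖1 + τ p‖ := by
      simp only [norm_prod]
    linarith
  have hhQ : ‖(∑ n ∈ range Q, h n) / (Q : ℂ)‖ ≤ 1 := by
    rw [norm_div, Complex.norm_natCast, div_le_one (by linarith)]
    calc _ ≤ ∑ n ∈ range Q, (1 : ℝ) := norm_sum_le_of_le _ fun n _ => h1 n
      _ = _ := by simp
  have hA : ‖∑ n ∈ range N, h n * ∏ j, truncProd (fun p => t p n) (k j) (P j)‖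
      ≤ N * (∏ j, ∏ p ∈ P j, ‖1 + τ p‖ + (∏ j, (1 + E j) - 1)) + 2 * Q * R := by
    have h2 := (norm_sub_norm_le _ _).trans hmain
    have h3 : ‖(N : ℂ) * ((∑ n ∈ range Q, h n) / Q) * ∏ j, truncProd τ (k j) (P j)‖
        ≤ N * 1 * (∏ j, ∏ p ∈ P j, ‖1 + τ p‖ + (∏ j, (1 + E j) - 1)) := by
      rw [norm_mul, norm_mul, Complex.norm_natCast]
      gcongr
    have h4 : 2 * (Q : ℝ) * ∏ j, ∑ S ∈ (P j).powerset with #S ≤ k j, (4 : ℝ) ^ #S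
        ≤ 2 * Q * R := by gcongr
    simp only [hτ] at h3 ⊢
    linarith
  have hB := sum_prod_one_add_elemSymm_le P hdisj (fun j p hp => (hP j p hp).1) ht h4 k N
  have hB2 : 2 * R ≤ 2 * Q * R := by nlinarith
  have hC : ‖∑ n ∈ range N, h n * ∏ j, ∏ p ∈ P j, (1 + t p n)
      - ∑ n ∈ range N, h n * ∏ j, truncProd (fun p => t p n) (k j) (P j)‖
      ≤ ∑ n ∈ range N, (∏ j, (1 + elemSymm (fun p => ‖t p n‖) (k j + 1) (P j)) - 1) := by
    rw [← sum_sub_distrib]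
    refine norm_sum_le_of_le _ fun n _ => ?_
    rw [← mul_sub, norm_mul]
    have h2 := norm_prod_sub_prod_le univ (fun j => ∏ p ∈ P j, (1 + t p n))
      (fun j => truncProd (fun p => t p n) (k j) (P j))
      (fun j => elemSymm (fun p => ‖t p n‖) (k j + 1) (P j))
      (fun j _ => norm_prod_one_add_le_one fun p hp => ht1 j p hp n)
      (fun j _ => norm_prod_sub_truncProd_le (P j) (fun p hp => ht1 j p hp n) (k j))
    calc _ ≤ 1 * ‖∏ j, ∏ p ∈ P j, (1 + t p n) - ∏ j, truncProd (fun p => t p n) (k j) (P j)‖ := by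
          gcongr; exact h1 n
      _ ≤ _ := by rw [one_mul]; exact h2
  rw [sum_sub_distrib, sum_const, card_range, nsmul_eq_mul, mul_one] at hC
  have hD := (norm_sub_norm_le _ _).trans hC
  linarith

/-- The primes `p` with `a < p ≤ b`. -/
def primesIoc (a b : ℝ) : Finset ℕ := (Ioc 0 ⌊b⌋₊).filter fun p => p.Prime ∧ a < p

lemma mem_primesIoc {a b : ℝ} (hb : 0 ≤ b) {p : ℕ} :
    p ∈ primesIoc a b ↔ p.Prime ∧ a < p ∧ (p : ℝ) ≤ b := by
  simp only [primesIoc, mem_filter, mem_Ioc]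
  constructor
  · rintro ⟨⟨_, h⟩, hp, ha⟩
    exact ⟨hp, ha, (Nat.le_floor_iff hb).1 h⟩
  · rintro ⟨hp, ha, h⟩
    exact ⟨⟨hp.pos, (Nat.le_floor_iff hb).2 h⟩, hp, ha⟩

lemma primesIoc_union {a b c : ℝ} (hab : a ≤ b) (hbc : b ≤ c) (hb : 0 ≤ b) :
    primesIoc a c = primesIoc a b ∪ primesIoc b c := by
  ext p
  rw [mem_union, mem_primesIoc (hb.trans hbc), mem_primesIoc hb, mem_primesIoc (hb.trans hbc)]
  constructor
  · rintro ⟨hp, h1, h2⟩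
    rcases le_or_gt (p : ℝ) b with h | h
    · exact Or.inl ⟨hp, h1, h⟩
    · exact Or.inr ⟨hp, h, h2⟩
  · rintro (⟨hp, h1, h2⟩ | ⟨hp, h1, h2⟩)
    · exact ⟨hp, h1, h2.trans hbc⟩
    · exact ⟨hp, hab.trans_lt h1, h2⟩

lemma disjoint_primesIoc {a b c d : ℝ} (hbc : b ≤ c) (hb : 0 ≤ b) (hd : 0 ≤ d) :
    Disjoint (primesIoc a b) (primesIoc c d) := by
  rw [disjoint_left]
  intro p h1 h2
  rw [mem_primesIoc hb] at h1
  rw [mem_primesIoc hd] at h2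
  linarith [h1.2.2, h2.2.1]

lemma card_primesIoc_le {a b : ℝ} (hb : 0 ≤ b) : (#(primesIoc a b) : ℝ) ≤ b := by
  calc (#(primesIoc a b) : ℝ) ≤ #(Ioc 0 ⌊b⌋₊) := by
        exact_mod_cast card_le_card (filter_subset _ _)
    _ ≤ b := by simpa using Nat.floor_le hb

/-! ### Sums over primes -/

lemma sum_log_primeFactors_le {m : ℕ} (hm : m ≠ 0) :
    ∑ p ∈ m.primeFactors, Real.log p ≤ Real.log m := by
  rw [← Real.log_prod (fun p hp => by exact_mod_cast (Nat.prime_of_mem_primeFactors hp).ne_zero)]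
  apply Real.log_le_log
  · exact prod_pos fun p hp => by exact_mod_cast (Nat.prime_of_mem_primeFactors hp).pos
  · rw [← Nat.cast_prod]
    exact_mod_cast Nat.le_of_dvd (Nat.pos_of_ne_zero hm) (Nat.prod_primeFactors_dvd m)

lemma sum_log_mul_div_le (n : ℕ) :
    ∑ p ∈ Ioc 0 n with p.Prime, Real.log p * (n / p : ℕ) ≤ n * Real.log n := by
  have h1 : ∀ p : ℕ, Real.log p * (n / p : ℕ) = ∑ m ∈ Ioc 0 n, if p ∣ m then Real.log p else 0 := by
    intro p
    rw [← Nat.Ioc_filter_dvd_card_eq_div n p, ← sum_filter, sum_const, nsmul_eq_mul, mul_comm]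
  simp only [h1]
  rw [sum_comm]
  calc _ ≤ ∑ m ∈ Ioc 0 n, Real.log n := sum_le_sum fun m hm => ?_
    _ = _ := by simp
  rw [mem_Ioc] at hm
  rw [← sum_filter]
  calc _ = ∑ p ∈ m.primeFactors, Real.log p := by
        refine sum_congr ?_ fun _ _ => rfl
        ext p
        simp only [mem_filter, mem_Ioc, Nat.mem_primeFactors]
        constructor
        · rintro ⟨⟨_, h2⟩, h3⟩
          exact ⟨h2, h3, hm.1.ne'⟩
        · rintro ⟨h2, h3, _⟩
          exact ⟨⟨⟨h2.pos, (Nat.le_of_dvd hm.1 h3).trans hm.2⟩, h2⟩, h3⟩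
    _ ≤ Real.log m := sum_log_primeFactors_le hm.1.ne'
    _ ≤ _ := Real.log_le_log (by exact_mod_cast hm.1) (by exact_mod_cast hm.2)

lemma sum_log_div_le {n : ℕ} (hn : 0 < n) :
    ∑ p ∈ Ioc 0 n with p.Prime, Real.log p / p ≤ Real.log n + Real.log 4 := by
  have hn' : (0 : ℝ) < n := by exact_mod_cast hn
  have hθ : ∑ p ∈ Ioc 0 n with p.Prime, Real.log p ≤ Real.log 4 * n := by
    have := Chebyshev.theta_le_log4_mul_x (x := n) hn'.le
    rwa [Chebyshev.theta, Nat.floor_natCast] at this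
  have h2 := sum_log_mul_div_le n
  have h3 : n * ∑ p ∈ Ioc 0 n with p.Prime, Real.log p / p
      ≤ ∑ p ∈ Ioc 0 n with p.Prime, (Real.log p * (n / p : ℕ) + Real.log p) := by
    rw [mul_sum]
    refine sum_le_sum fun p hp => ?_
    have hp' : (0 : ℝ) < p := by
      exact_mod_cast (mem_filter.1 hp).2.pos
    have hlog : 0 ≤ Real.log p := Real.log_natCast_nonneg p
    have h4 : (n : ℝ) / p ≤ (n / p : ℕ) + 1 := by
      rw [← Nat.floor_div_eq_div (K := ℝ)]
      exact (Nat.lt_floor_add_one _).le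
    calc _ = Real.log p * (n / p) := by ring
      _ ≤ Real.log p * ((n / p : ℕ) + 1) := by gcongr
      _ = _ := by ring
  rw [sum_add_distrib] at h3
  have : n * ∑ p ∈ Ioc 0 n with p.Prime, Real.log p / p ≤ n * (Real.log n + Real.log 4) := by
    linarith
  exact le_of_mul_le_mul_left this hn'

lemma sum_inv_primesIoc_sqrt_le {Y : ℝ} (hY : 1 ≤ Y) :
    ∑ p ∈ primesIoc (√Y) Y, (1 : ℝ) / p ≤ 6 := by
  have hY0 : 0 ≤ Y := by linarith
  rcases lt_or_ge Y 2 with h2 | h2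
  · have : primesIoc (√Y) Y = ∅ := by
      rw [eq_empty_iff_forall_notMem]
      intro p hp
      rw [mem_primesIoc hY0] at hp
      have : (2 : ℝ) ≤ p := by exact_mod_cast hp.1.two_le
      linarith [hp.2.2]
    rw [this]
    norm_num
  have hlog2 : Real.log 2 ≤ Real.log Y := Real.log_le_log (by norm_num) h2
  have hlog2' : 0 < Real.log 2 := Real.log_pos (by norm_num)
  have hlogY : 0 < Real.log Y := by linarith
  have hlog4 : Real.log 4 = 2 * Real.log 2 := by
    rw [show (4 : ℝ) = 2 ^ 2 by norm_num, Real.log_pow]; norm_num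
  have hfl : 0 < ⌊Y⌋₊ := Nat.floor_pos.2 hY
  have hsum := sum_log_div_le hfl
  have hfl2 : Real.log ⌊Y⌋₊ ≤ Real.log Y :=
    Real.log_le_log (by exact_mod_cast hfl) (Nat.floor_le hY0)
  calc _ ≤ ∑ p ∈ primesIoc (√Y) Y, 2 / Real.log Y * (Real.log p / p) := by
        refine sum_le_sum fun p hp => ?_
        rw [mem_primesIoc hY0] at hp
        have hp0 : (0 : ℝ) < p := by exact_mod_cast hp.1.pos
        have h3 : Real.log Y / 2 ≤ Real.log p := by
          rw [← Real.log_sqrt hY0]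
          exact Real.log_le_log (Real.sqrt_pos.2 (by linarith)) hp.2.1.le
        rw [div_mul_div_comm]
        rw [div_le_div_iff₀ hp0 (by positivity)]
        nlinarith
    _ ≤ 2 / Real.log Y * ∑ p ∈ Ioc 0 ⌊Y⌋₊ with p.Prime, Real.log p / p := by
        rw [← mul_sum]
        gcongr
        intro p hp
        simp only [primesIoc, mem_filter] at hp ⊢
        exact ⟨hp.1, hp.2.1⟩
    _ ≤ 2 / Real.log Y * (3 * Real.log Y) := by
        gcongr; linarith
    _ = 6 := by field_simp; norm_num

lemma sum_inv_sq_primesIoc_le {z y : ℝ} (hz : 1 ≤ z) :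
    ∑ p ∈ primesIoc z y, (1 : ℝ) / p ^ 2 ≤ 2 / z := by
  have hk : ⌊z⌋₊ ≠ 0 := (Nat.floor_pos.2 hz).ne'
  have hz0 : 0 < z := by linarith
  rcases le_total ⌊y⌋₊ ⌊z⌋₊ with h | h
  · have : primesIoc z y = ∅ := by
      rw [eq_empty_iff_forall_notMem]
      intro p hp
      simp only [primesIoc, mem_filter, mem_Ioc] at hp
      have := Nat.floor_lt_ceil_of_lt_of_pos hp.2.2 (by linarith [hp.2.2])
      have := (Nat.floor_lt (by linarith)).2 hp.2.2
      omega
    rw [this]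
    simp; positivity
  have h1 := sum_Ioc_inv_sq_le_sub (α := ℝ) hk h
  calc _ ≤ ∑ i ∈ Ioc ⌊z⌋₊ ⌊y⌋₊, ((i : ℝ) ^ 2)⁻¹ := by
        simp only [one_div]
        refine sum_le_sum_of_subset_of_nonneg ?_ fun _ _ _ => by positivity
        intro p hp
        simp only [primesIoc, mem_filter, mem_Ioc] at hp ⊢
        exact ⟨(Nat.floor_lt (by linarith)).2 hp.2.2, hp.1.2⟩
    _ ≤ (⌊z⌋₊ : ℝ)⁻¹ := by
        have : (0 : ℝ) ≤ (⌊y⌋₊ : ℝ)⁻¹ := by positivity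
        linarith
    _ ≤ 2 / z := by
        have h1 : (1 : ℝ) ≤ ⌊z⌋₊ := by exact_mod_cast Nat.one_le_iff_ne_zero.2 hk
        have h2 := Nat.lt_floor_add_one z
        rw [inv_eq_one_div, div_le_div_iff₀ (by linarith) hz0]
        linarith

lemma sum_inv_primesIoc_zero_le {z : ℝ} (hz : 1 ≤ z) :
    ∑ p ∈ primesIoc 0 z, (1 : ℝ) / p ≤ 1 + Real.log z := by
  refine le_trans ?_ (harmonic_floor_le_one_add_log z hz)
  rw [harmonic_eq_sum_Icc]
  push_cast
  simp only [one_div]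
  refine sum_le_sum_of_subset_of_nonneg ?_ fun _ _ _ => by positivity
  intro p hp
  simp only [primesIoc, mem_filter, mem_Ioc, mem_Icc] at hp ⊢
  exact ⟨hp.1.1, hp.1.2⟩

lemma log_le_prod_primesBelow (n : ℕ) :
    Real.log (n + 1) ≤ ∏ p ∈ (n + 1).primesBelow, (1 - (p : ℝ)⁻¹)⁻¹ := by
  let f : ℕ →* ℝ :=
    { toFun := fun m => (m : ℝ)⁻¹
      map_one' := by simp
      map_mul' := fun a b => by push_cast; rw [mul_inv] }
  have hf : ∀ {p : ℕ}, p.Prime → ‖f p‖ < 1 := by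
    intro p hp
    have : (1 : ℝ) < p := by exact_mod_cast hp.one_lt
    simpa [f] using inv_lt_one_of_one_lt₀ this
  obtain ⟨-, hs⟩ := EulerProduct.summable_and_hasSum_smoothNumbers_prod_primesBelow_geometric hf (n + 1)
  have h1 := log_add_one_le_harmonic n
  rw [harmonic_eq_sum_Icc] at h1
  push_cast at h1
  refine h1.trans ?_
  have hmem : ∀ i ∈ Icc 1 n, i ∈ (n + 1).smoothNumbers := fun i hi => by
    rw [mem_Icc] at hi
    exact Nat.mem_smoothNumbers_of_lt hi.1 (by omega)
  classical
  have := sum_le_hasSum ((Icc 1 n).subtype (· ∈ (n + 1).smoothNumbers)) (fun i _ => by simp [f]) hs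
  rwa [sum_subtype_of_mem (fun i => f i) hmem] at this

lemma loglog_sub_two_le_sum_inv_primes {y : ℝ} (hy : 2 ≤ y) :
    Real.log (Real.log y) - 2 ≤ ∑ p ∈ primesIoc 0 y, (1 : ℝ) / p := by
  have hy0 : 0 ≤ y := by linarith
  have hset : (⌊y⌋₊ + 1).primesBelow = primesIoc 0 y := by
    ext p
    rw [mem_primesIoc hy0, Nat.mem_primesBelow, Nat.lt_succ_iff, Nat.le_floor_iff hy0]
    constructor
    · rintro ⟨h, hp⟩
      exact ⟨hp, by exact_mod_cast hp.pos, h⟩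
    · rintro ⟨hp, _, h⟩
      exact ⟨h, hp⟩
  have h1 := log_le_prod_primesBelow ⌊y⌋₊
  rw [hset] at h1
  have hlog : 0 < Real.log y := Real.log_pos (by linarith)
  have h2 : Real.log y ≤ Real.exp (∑ p ∈ primesIoc 0 y, (1 : ℝ) / p + 2) := by
    calc Real.log y ≤ Real.log (⌊y⌋₊ + 1) :=
          Real.log_le_log (by linarith) (Nat.lt_floor_add_one y).le
      _ ≤ _ := h1
      _ ≤ ∏ p ∈ primesIoc 0 y, Real.exp ((1 : ℝ) / p + 2 * (1 / p ^ 2)) := by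
          refine prod_le_prod (fun p hp => ?_) fun p hp => ?_
          all_goals
            rw [mem_primesIoc hy0] at hp
            have hp2 : (2 : ℝ) ≤ p := by exact_mod_cast hp.1.two_le
          · have : (p : ℝ)⁻¹ ≤ 1 := inv_le_one_of_one_le₀ (by linarith)
            exact inv_nonneg.2 (by linarith)
          · calc (1 - (p : ℝ)⁻¹)⁻¹ = 1 + 1 / (p - 1) := by
                  have : (p : ℝ) - 1 ≠ 0 := by linarith
                  field_simp
                  ring
              _ ≤ 1 + (1 / p + 2 * (1 / p ^ 2)) := by
                  have h3 : (0 : ℝ) < p - 1 := by linarith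
                  gcongr
                  rw [show (1 : ℝ) / p + 2 * (1 / p ^ 2) = (p + 2) / p ^ 2 by field_simp,
                    div_le_div_iff₀ h3 (by positivity)]
                  nlinarith
              _ ≤ _ := by
                  rw [add_comm]; exact Real.add_one_le_exp _
      _ = Real.exp (∑ p ∈ primesIoc 0 y, (1 : ℝ) / p + 2 * ∑ p ∈ primesIoc 0 y, (1 : ℝ) / p ^ 2) := by
          rw [← Real.exp_sum, sum_add_distrib, mul_sum]
      _ ≤ _ := by
          have h4 : primesIoc 0 y ⊆ Ioc 1 ⌊y⌋₊ := by
            intro p hp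
            simp only [primesIoc, mem_filter, mem_Ioc] at hp ⊢
            exact ⟨hp.2.1.one_lt, hp.1.2⟩
          have h5 : ∑ p ∈ primesIoc 0 y, (1 : ℝ) / p ^ 2 ≤ 1 := by
            simp only [one_div]
            refine (sum_le_sum_of_subset_of_nonneg h4 fun _ _ _ => by positivity).trans ?_
            refine (sum_Ioc_inv_sq_le_sub (α := ℝ) one_ne_zero
              (Nat.floor_pos.2 (by linarith))).trans ?_
            have : (0 : ℝ) ≤ (⌊y⌋₊ : ℝ)⁻¹ := by positivity
            push_cast
            linarith
          gcongr
          linarith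
  have := (Real.log_le_log hlog h2)
  rw [Real.log_exp] at this
  linarith

lemma loglog_sub_le_sum_inv_primesIoc {z y : ℝ} (hz : 1 ≤ z) (hzy : z ≤ y) (hy : 2 ≤ y) :
    Real.log (Real.log y) - 3 - Real.log z ≤ ∑ p ∈ primesIoc z y, (1 : ℝ) / p := by
  have h1 := loglog_sub_two_le_sum_inv_primes hy
  have h2 := sum_inv_primesIoc_zero_le hz
  rw [primesIoc_union (by linarith : (0 : ℝ) ≤ z) hzy (by linarith),
    sum_union (disjoint_primesIoc le_rfl (by linarith) (by linarith))] at h1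
  linarith

/-! ### Blocks of primes -/

/-- The sequence `y, √y, √√y, …`, cut at `z`. -/
def sqrtSeq (z y : ℝ) (j : ℕ) : ℝ := max z (y ^ ((1 / 2 : ℝ) ^ j))

section Blocks

variable {z y : ℝ}

lemma sqrtSeq_zero (hzy : z ≤ y) : sqrtSeq z y 0 = y := by simp [sqrtSeq, hzy]

lemma sqrtSeq_nonneg (hz : 0 ≤ z) (j : ℕ) : 0 ≤ sqrtSeq z y j := hz.trans (le_max_left _ _)

lemma sqrtSeq_antitone (hy : 1 ≤ y) : Antitone (sqrtSeq z y) := by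
  intro i j hij
  refine max_le_max le_rfl (Real.rpow_le_rpow_of_exponent_le hy ?_)
  exact pow_le_pow_of_le_one (by norm_num) (by norm_num) hij

lemma exists_sqrtSeq_eq (hz : 1 < z) (hy : 1 ≤ y) : ∃ J, sqrtSeq z y J = z := by
  have h1 : Filter.Tendsto (fun j : ℕ => y ^ ((1 / 2 : ℝ) ^ j)) Filter.atTop (nhds (y ^ (0 : ℝ))) :=
    (Real.continuousAt_const_rpow (by linarith)).tendsto.comp
      (tendsto_pow_atTop_nhds_zero_of_lt_one (by norm_num) (by norm_num))
  rw [Real.rpow_zero] at h1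
  obtain ⟨J, hJ⟩ := (h1.eventually (gt_mem_nhds hz)).exists
  exact ⟨J, max_eq_left hJ.le⟩

/-- The `j`-th block of primes. -/
def primeBlock (z y : ℝ) (j : ℕ) : Finset ℕ := primesIoc (sqrtSeq z y (j + 1)) (sqrtSeq z y j)

lemma mem_primeBlock_imp (hz : 0 ≤ z) {j p : ℕ} (hp : p ∈ primeBlock z y j) :
    p.Prime ∧ z < p := by
  rw [primeBlock, mem_primesIoc (sqrtSeq_nonneg hz j)] at hp
  exact ⟨hp.1, (le_max_left _ _).trans_lt hp.2.1⟩

lemma disjoint_primeBlock (hz : 0 ≤ z) (hy : 1 ≤ y) {i j : ℕ} (hij : i ≠ j) :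
    Disjoint (primeBlock z y i) (primeBlock z y j) := by
  wlog h : i < j generalizing i j
  · exact (this hij.symm (by omega)).symm
  exact (disjoint_primesIoc (sqrtSeq_antitone hy (by omega)) (sqrtSeq_nonneg hz _)
    (sqrtSeq_nonneg hz _)).symm

@[to_additive]
lemma prod_primeBlock {M : Type*} [CommMonoid M] (f : ℕ → M) (hz : 0 ≤ z) (hy : 1 ≤ y)
    (hzy : z ≤ y) (J : ℕ) :
    ∏ j ∈ range J, ∏ p ∈ primeBlock z y j, f p = ∏ p ∈ primesIoc (sqrtSeq z y J) y, f p := by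
  have hy0 : 0 ≤ y := by linarith
  induction J with
  | zero =>
    rw [sqrtSeq_zero hzy]
    have : primesIoc y y = ∅ := by
      rw [eq_empty_iff_forall_notMem]
      intro p hp
      rw [mem_primesIoc hy0] at hp
      linarith [hp.2.1, hp.2.2]
    simp [this]
  | succ J ih =>
    have h1 : sqrtSeq z y J ≤ y := by
      conv_rhs => rw [← sqrtSeq_zero hzy]
      exact sqrtSeq_antitone hy (Nat.zero_le J)
    rw [prod_range_succ, ih, primesIoc_union (sqrtSeq_antitone hy (Nat.le_succ J)) h1
      (sqrtSeq_nonneg hz J), prod_union (disjoint_primesIoc le_rfl (sqrtSeq_nonneg hz J) hy0),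
      mul_comm, primeBlock]

lemma primeBlock_eq_empty (hz : 0 ≤ z) {j : ℕ} (h : y ^ ((1 / 2 : ℝ) ^ j) ≤ z) :
    primeBlock z y j = ∅ := by
  rw [eq_empty_iff_forall_notMem]
  intro p hp
  have h1 := mem_primeBlock_imp hz hp
  rw [primeBlock, mem_primesIoc (sqrtSeq_nonneg hz j)] at hp
  have : sqrtSeq z y j = z := max_eq_left h
  linarith [hp.2.2]

lemma sum_inv_primeBlock_le (hz : 0 ≤ z) (hy : 1 ≤ y) (j : ℕ) :
    ∑ p ∈ primeBlock z y j, (1 : ℝ) / p ≤ 6 := by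
  rcases le_or_gt (y ^ ((1 / 2 : ℝ) ^ j)) z with h | h
  · rw [primeBlock_eq_empty hz h]; norm_num
  · have hY : 1 ≤ y ^ ((1 / 2 : ℝ) ^ j) := Real.one_le_rpow hy (by positivity)
    refine le_trans ?_ (sum_inv_primesIoc_sqrt_le hY)
    refine sum_le_sum_of_subset_of_nonneg (fun p hp => ?_) fun _ _ _ => by positivity
    rw [primeBlock, mem_primesIoc (sqrtSeq_nonneg hz j)] at hp
    rw [mem_primesIoc (by linarith)]
    refine ⟨hp.1, lt_of_le_of_lt ?_ hp.2.1, ?_⟩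
    · rw [sqrtSeq, Real.sqrt_eq_rpow, ← Real.rpow_mul (by linarith), ← pow_succ]
      exact le_max_right _ _
    · have h3 := hp.2.2
      rwa [sqrtSeq, max_eq_right h.le] at h3

lemma one_add_card_primeBlock_le (hz : 5 ≤ z) (hy : 1 ≤ y) (j : ℕ) :
    1 + 4 * (#(primeBlock z y j) : ℝ) ≤ Real.exp (2 * ((1 / 2 : ℝ) ^ j * Real.log y)) := by
  have hY : 1 ≤ y ^ ((1 / 2 : ℝ) ^ j) := Real.one_le_rpow hy (by positivity)
  have e : Real.exp (2 * ((1 / 2 : ℝ) ^ j * Real.log y)) = (y ^ ((1 / 2 : ℝ) ^ j)) ^ 2 := by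
    rw [Real.rpow_def_of_pos (by linarith), ← Real.exp_nat_mul]
    congr 1
    push_cast
    ring
  rw [e]
  rcases le_or_gt (y ^ ((1 / 2 : ℝ) ^ j)) z with h | h
  · rw [primeBlock_eq_empty (by linarith) h]
    simp only [card_empty, Nat.cast_zero]
    nlinarith
  · have h1 : (#(primeBlock z y j) : ℝ) ≤ sqrtSeq z y j :=
      card_primesIoc_le (sqrtSeq_nonneg (by linarith) j)
    rw [sqrtSeq, max_eq_right h.le] at h1
    nlinarith

end Blocks

lemma sum_pow_half (K J : ℕ) :
    ∑ j ∈ range J, ((K + j : ℕ) : ℝ) * (1 / 2) ^ j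
      = 2 * K + 2 - (2 * K + 2 * J + 2) * (1 / 2) ^ J := by
  induction J with
  | zero => simp
  | succ J ih =>
    rw [sum_range_succ, ih]
    push_cast
    ring

/-- The mean value of a twisted product over primes in `(z, y]`. -/
theorem norm_sum_mul_prod_primes_le : ∃ C : ℝ, 0 < C ∧ ∀ (h : ℕ → ℂ) (t : ℕ → ℕ → ℂ) (Q : ℕ)
    (z y : ℝ) (K N : ℕ), 0 < Q → Function.Periodic h Q → (∀ n, ‖h n‖ ≤ 1) → 5 ≤ z → z ≤ y →
    (∀ p : ℕ, p.Prime → z < p → Q.Coprime p ∧ Function.Periodic (t p) p ∧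
      ∑ n ∈ range p, ‖t p n‖ ≤ 4 ∧ ∀ n, ‖1 + t p n‖ ≤ 1) →
    ‖∑ n ∈ range N, h n * ∏ p ∈ primesIoc z y, (1 + t p n)‖
      ≤ N * (∏ p ∈ primesIoc z y, ‖1 + (∑ n ∈ range p, t p n) / p‖
          + C * (24 ^ (K + 1) / (K + 1).factorial))
        + 4 * Q * Real.exp ((4 * K + 8) * Real.log y) := by
  refine ⟨2 * (Real.exp 24 * Real.exp (Real.exp 24 * Real.exp 24)), by positivity, ?_⟩
  intro h t Q z y K N hQ hh h1 hz hzy hyp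
  have hz0 : 0 ≤ z := by linarith
  have hy : 1 ≤ y := by linarith
  have hlogy : 0 ≤ Real.log y := Real.log_nonneg hy
  obtain ⟨J, hJ⟩ := exists_sqrtSeq_eq (z := z) (y := y) (by linarith) hy
  have hprod : ∀ {M : Type} [CommMonoid M] (f : ℕ → M),
      ∏ p ∈ primesIoc z y, f p = ∏ j : Fin J, ∏ p ∈ primeBlock z y j, f p := by
    intro M _ f
    rw [Fin.prod_univ_eq_prod_range (fun j => ∏ p ∈ primeBlock z y j, f p) J,
      prod_primeBlock f hz0 hy hzy, hJ]
  have key := norm_sum_mul_prod_blocks_le (t := t) hQ hh h1 (fun j : Fin J => primeBlock z y j)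
    (fun i j hij => disjoint_primeBlock hz0 hy (by simpa [Fin.ext_iff] using hij))
    (fun j p hp => ⟨(mem_primeBlock_imp hz0 hp).1,
      (hyp p (mem_primeBlock_imp hz0 hp).1 (mem_primeBlock_imp hz0 hp).2).1⟩)
    (fun j p hp => (hyp p (mem_primeBlock_imp hz0 hp).1 (mem_primeBlock_imp hz0 hp).2).2.1)
    (fun j p hp => (hyp p (mem_primeBlock_imp hz0 hp).1 (mem_primeBlock_imp hz0 hp).2).2.2.1)
    (fun j p hp => (hyp p (mem_primeBlock_imp hz0 hp).1 (mem_primeBlock_imp hz0 hp).2).2.2.2)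
    (fun j => K + j) N
  simp only [hprod]
  refine key.trans ?_
  set η : ℝ := 24 ^ (K + 1) / (K + 1).factorial with hη
  have hη0 : 0 ≤ η := by positivity
  have hη1 : η ≤ Real.exp 24 := Real.pow_div_factorial_le_exp 24 (by norm_num) (K + 1)
  have hE : ∀ j : ℕ, elemSymm (fun p : ℕ => 4 / (p : ℝ)) (K + j + 1) (primeBlock z y j)
      ≤ η * (24 ^ j / j.factorial) := by
    intro j
    refine (elemSymm_le_pow_div_factorial (fun p => by positivity) _ _).trans ?_
    have h2 : ∑ p ∈ primeBlock z y j, 4 / (p : ℝ) ≤ 24 := by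
      have := sum_inv_primeBlock_le hz0 hy j
      calc _ = 4 * ∑ p ∈ primeBlock z y j, (1 : ℝ) / p := by
            rw [mul_sum]; refine sum_congr rfl fun p _ => by ring
        _ ≤ _ := by linarith
    have h3 : (0 : ℝ) ≤ ∑ p ∈ primeBlock z y j, 4 / (p : ℝ) := sum_nonneg fun _ _ => by positivity
    have h4 : (((K + 1).factorial : ℝ) * j.factorial) ≤ (K + j + 1).factorial := by
      have := Nat.le_of_dvd (Nat.factorial_pos _) (Nat.factorial_mul_factorial_dvd_factorial_add (K + 1) j)
      rw [show K + 1 + j = K + j + 1 by ring] at this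
      exact_mod_cast this
    calc _ ≤ (24 : ℝ) ^ (K + j + 1) / ((K + 1).factorial * j.factorial) := by
          gcongr
      _ = _ := by rw [hη, show K + j + 1 = K + 1 + j by ring, pow_add]; field_simp
  have hsum : ∑ j : Fin J, η * ((24 : ℝ) ^ (j : ℕ) / (j : ℕ).factorial) ≤ η * Real.exp 24 := by
    rw [← mul_sum]
    gcongr
    rw [Fin.sum_univ_eq_sum_range (fun j => (24 : ℝ) ^ j / j.factorial) J]
    exact Real.sum_le_exp_of_nonneg (by norm_num) J
  have hP : ∏ j : Fin J, (1 + elemSymm (fun p : ℕ => 4 / (p : ℝ)) (K + j + 1) (primeBlock z y j)) - 1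
      ≤ η * (Real.exp 24 * Real.exp (Real.exp 24 * Real.exp 24)) := by
    have h2 : ∏ j : Fin J, (1 + elemSymm (fun p : ℕ => 4 / (p : ℝ)) (K + j + 1) (primeBlock z y j))
        ≤ Real.exp (η * Real.exp 24) := by
      calc _ ≤ ∏ j : Fin J, (1 + η * ((24 : ℝ) ^ (j : ℕ) / (j : ℕ).factorial)) := by
            refine prod_le_prod (fun j _ => ?_) fun j _ => ?_
            · exact add_nonneg zero_le_one (elemSymm_nonneg (fun p => by positivity) _ _)
            · linarith [hE j]
        _ ≤ Real.exp (∑ j : Fin J, η * ((24 : ℝ) ^ (j : ℕ) / (j : ℕ).factorial)) :=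
            Real.prod_one_add_le_exp_sum _ (fun j => by positivity)
        _ ≤ _ := Real.exp_le_exp.2 hsum
    have h3 : ∀ s : ℝ, Real.exp s - 1 ≤ s * Real.exp s := by
      intro s
      have := Real.add_one_le_exp (-s)
      have h5 : Real.exp s * Real.exp (-s) = 1 := by rw [← Real.exp_add]; simp
      nlinarith [Real.exp_pos s]
    have h4 : Real.exp (η * Real.exp 24) ≤ Real.exp (Real.exp 24 * Real.exp 24) := by
      gcongr
    calc _ ≤ Real.exp (η * Real.exp 24) - 1 := by linarith
      _ ≤ η * Real.exp 24 * Real.exp (η * Real.exp 24) := h3 _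
      _ ≤ η * Real.exp 24 * Real.exp (Real.exp 24 * Real.exp 24) := by gcongr
      _ = _ := by ring
  have hR : ∏ j : Fin J, (1 + 4 * (#(primeBlock z y j) : ℝ)) ^ (K + j + 1)
      ≤ Real.exp ((4 * K + 8) * Real.log y) := by
    calc _ ≤ ∏ j : Fin J, Real.exp (2 * Real.log y * (((K + 1 + j : ℕ) : ℝ) * (1 / 2) ^ (j : ℕ))) := by
          refine prod_le_prod (fun j _ => by positivity) fun j _ => ?_
          calc _ ≤ (Real.exp (2 * ((1 / 2 : ℝ) ^ (j : ℕ) * Real.log y))) ^ (K + j + 1) := by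
                gcongr; exact one_add_card_primeBlock_le hz hy j
            _ = _ := by
                rw [← Real.exp_nat_mul]
                congr 1
                push_cast
                ring
      _ = Real.exp (2 * Real.log y * ∑ j ∈ range J, ((K + 1 + j : ℕ) : ℝ) * (1 / 2) ^ j) := by
          rw [← Real.exp_sum, mul_sum,
            Fin.sum_univ_eq_sum_range
              (fun j => 2 * Real.log y * (((K + 1 + j : ℕ) : ℝ) * (1 / 2) ^ j)) J]
      _ ≤ _ := by
          rw [sum_pow_half]
          have : (0 : ℝ) ≤ (2 * (K + 1 : ℕ) + 2 * J + 2) * (1 / 2) ^ J := by positivity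
          push_cast at this ⊢
          refine Real.exp_le_exp.2 ?_
          nlinarith [mul_nonneg hlogy this]
  have hQ0 : (0 : ℝ) ≤ 4 * Q := by positivity
  have hN0 : (0 : ℝ) ≤ N := by positivity
  refine add_le_add (mul_le_mul_of_nonneg_left ?_ hN0) (mul_le_mul_of_nonneg_left hR hQ0)
  linarith

/-- `μ²(n) ζ^{ω_y(n)}`. -/
def sqfTwist (ζ : ℂ) (y : ℝ) (n : ℕ) : ℂ :=
  ((ArithmeticFunction.moebius n ^ 2 : ℤ) : ℂ) * ζ ^ omegaTrunc y n

/-- The contribution of the primes up to `z` to `sqfTwist ζ y n`. -/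
def smallPart (ζ : ℂ) (z n : ℕ) : ℂ :=
  ∏ p ∈ primesIoc 0 z, if p ^ 2 ∣ n then 0 else if p ∣ n then ζ else 1

/-- The contribution of the primes in `(z, y]` to `sqfTwist ζ y n`. -/
def largePart (ζ : ℂ) (z : ℕ) (y : ℝ) (n : ℕ) : ℂ :=
  ∏ p ∈ primesIoc z y, if p ∣ n then ζ else 1

lemma norm_smallPart_le {ζ : ℂ} (hζ : ‖ζ‖ = 1) (z n : ℕ) : ‖smallPart ζ z n‖ ≤ 1 := by
  rw [smallPart, norm_prod]
  refine prod_le_one (fun _ _ => norm_nonneg _) fun p _ => ?_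
  split_ifs <;> simp [hζ]

lemma norm_largePart_le {ζ : ℂ} (hζ : ‖ζ‖ = 1) (z : ℕ) (y : ℝ) (n : ℕ) :
    ‖largePart ζ z y n‖ ≤ 1 := by
  rw [largePart, norm_prod]
  refine prod_le_one (fun _ _ => norm_nonneg _) fun p _ => ?_
  split_ifs <;> simp [hζ]

lemma moebius_sq_eq_one {n : ℕ} (hn : Squarefree n) : ArithmeticFunction.moebius n ^ 2 = 1 := by
  rw [← sq_abs, ArithmeticFunction.abs_moebius_eq_one_of_squarefree hn]; norm_num

lemma moebius_sq_eq_zero {n : ℕ} (hn : ¬ Squarefree n) : ArithmeticFunction.moebius n ^ 2 = 0 := by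
  rw [ArithmeticFunction.moebius_eq_zero_of_not_squarefree hn]; norm_num

lemma norm_sqfTwist_le {ζ : ℂ} (hζ : ‖ζ‖ = 1) (y : ℝ) (n : ℕ) : ‖sqfTwist ζ y n‖ ≤ 1 := by
  rw [sqfTwist, norm_mul, norm_pow, hζ, one_pow, mul_one]
  by_cases h : Squarefree n
  · rw [moebius_sq_eq_one h]; simp
  · rw [moebius_sq_eq_zero h]; simp

lemma pow_omegaTrunc_eq_prod (ζ : ℂ) {y : ℝ} (hy : 0 ≤ y) {n : ℕ} (hn : n ≠ 0) :
    ζ ^ omegaTrunc y n = ∏ p ∈ primesIoc 0 y, if p ∣ n then ζ else 1 := by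
  rw [← prod_filter, prod_const, omegaTrunc]
  congr 2
  ext p
  rw [mem_filter, mem_filter, mem_primesIoc hy, Nat.mem_primeFactors]
  constructor
  · rintro ⟨⟨h1, h2, _⟩, h3⟩
    exact ⟨⟨h1, by exact_mod_cast h1.pos, h3⟩, h2⟩
  · rintro ⟨⟨h1, _, h3⟩, h2⟩
    exact ⟨⟨h1, h2, hn⟩, h3⟩

/-- `n` is divisible by the square of a prime larger than `z`. -/
def HasLargeSquare (z n : ℕ) : Prop := ∃ p : ℕ, p.Prime ∧ z < p ∧ p ^ 2 ∣ n

lemma sqfTwist_eq_mul {ζ : ℂ} {z : ℕ} {y : ℝ} (hzy : (z : ℝ) ≤ y) {n : ℕ} (hn : n ≠ 0)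
    (h : ¬ HasLargeSquare z n) : sqfTwist ζ y n = smallPart ζ z n * largePart ζ z y n := by
  have hz0 : (0 : ℝ) ≤ z := Nat.cast_nonneg z
  by_cases hsq : Squarefree n
  · rw [sqfTwist, moebius_sq_eq_one hsq, pow_omegaTrunc_eq_prod ζ (hz0.trans hzy) hn,
      primesIoc_union hz0 hzy hz0, prod_union (disjoint_primesIoc le_rfl hz0 (hz0.trans hzy)),
      smallPart, largePart]
    push_cast
    rw [one_mul]
    congr 1
    refine prod_congr rfl fun p hp => ?_
    rw [mem_primesIoc hz0] at hp
    have : ¬ p ^ 2 ∣ n := by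
      rw [sq]
      exact Nat.squarefree_iff_prime_squarefree.1 hsq p hp.1
    rw [if_neg this]
  · rw [sqfTwist, moebius_sq_eq_zero hsq]
    have h2 := mt Nat.squarefree_iff_prime_squarefree.2 hsq
    push Not at h2
    obtain ⟨p, hp, hpn⟩ := h2
    rw [← sq] at hpn
    have hpz : p ≤ z := by
      by_contra hc
      exact h ⟨p, hp, by omega, hpn⟩
    have : smallPart ζ z n = 0 := by
      refine prod_eq_zero (i := p) ?_ (if_pos hpn)
      rw [mem_primesIoc hz0]
      exact ⟨hp, by exact_mod_cast hp.pos, by exact_mod_cast hpz⟩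
    rw [this]
    simp

lemma sqfTwist_eq_zero {ζ : ℂ} {z : ℕ} {y : ℝ} {n : ℕ} (h : HasLargeSquare z n) :
    sqfTwist ζ y n = 0 := by
  obtain ⟨p, hp, _, hpn⟩ := h
  have : ¬ Squarefree n := fun hs => by
    rw [sq] at hpn
    exact Nat.squarefree_iff_prime_squarefree.1 hs p hp hpn
  rw [sqfTwist, moebius_sq_eq_zero this]
  simp

open Classical in
lemma card_hasLargeSquare_le {z : ℕ} (hz : 1 ≤ z) (M : ℕ) :
    (#{n ∈ Ioc 0 M | HasLargeSquare z n} : ℝ) ≤ 2 * M / z := by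
  have hsub : {n ∈ Ioc 0 M | HasLargeSquare z n}
      ⊆ (primesIoc z M).biUnion fun p => {n ∈ Ioc 0 M | p ^ 2 ∣ n} := by
    intro n hn
    obtain ⟨h1, p, hp, hzp, hpn⟩ := mem_filter.1 hn
    rw [mem_biUnion]
    refine ⟨p, ?_, mem_filter.2 ⟨h1, hpn⟩⟩
    rw [mem_primesIoc (Nat.cast_nonneg M)]
    refine ⟨hp, by exact_mod_cast hzp, ?_⟩
    have h2 := Nat.le_of_dvd (mem_Ioc.1 h1).1 hpn
    have h3 : p ≤ p ^ 2 := Nat.le_self_pow (by norm_num) p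
    exact_mod_cast (h3.trans h2).trans (mem_Ioc.1 h1).2
  calc (#{n ∈ Ioc 0 M | HasLargeSquare z n} : ℝ)
      ≤ ∑ p ∈ primesIoc z M, (#{n ∈ Ioc 0 M | p ^ 2 ∣ n} : ℝ) := by
        exact_mod_cast (card_le_card hsub).trans card_biUnion_le
    _ ≤ ∑ p ∈ primesIoc z M, M * ((1 : ℝ) / p ^ 2) := by
        refine sum_le_sum fun p _ => ?_
        rw [Nat.Ioc_filter_dvd_card_eq_div]
        refine Nat.cast_div_le.trans (le_of_eq ?_)
        push_cast
        ring
    _ ≤ M * (2 / z) := by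
        rw [← mul_sum]
        gcongr
        exact sum_inv_sq_primesIoc_le (by exact_mod_cast hz)
    _ = _ := by ring

open Classical in
lemma norm_sqfTwist_mul_sub_le {ζ₁ ζ₂ : ℂ} (h1 : ‖ζ₁‖ = 1) (h2 : ‖ζ₂‖ = 1) {z : ℕ} {y : ℝ}
    (hzy : (z : ℝ) ≤ y) {m n : ℕ} (hm : m ≠ 0) (hn : n ≠ 0) :
    ‖sqfTwist ζ₁ y m * sqfTwist ζ₂ y n
        - (smallPart ζ₁ z m * largePart ζ₁ z y m) * (smallPart ζ₂ z n * largePart ζ₂ z y n)‖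
      ≤ (if HasLargeSquare z m then 1 else 0) + (if HasLargeSquare z n then 1 else 0) := by
  have hb : ∀ {ζ : ℂ} (_ : ‖ζ‖ = 1) (k : ℕ), ‖smallPart ζ z k * largePart ζ z y k‖ ≤ 1 := by
    intro ζ hζ k
    rw [norm_mul]
    exact mul_le_one₀ (norm_smallPart_le hζ z k) (norm_nonneg _) (norm_largePart_le hζ z y k)
  have hb2 : ‖(smallPart ζ₁ z m * largePart ζ₁ z y m) * (smallPart ζ₂ z n * largePart ζ₂ z y n)‖
      ≤ 1 := by
    rw [norm_mul]
    exact mul_le_one₀ (hb h1 m) (norm_nonneg _) (hb h2 n)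
  by_cases hm' : HasLargeSquare z m
  · rw [sqfTwist_eq_zero hm', zero_mul, zero_sub, norm_neg, if_pos hm']
    refine hb2.trans (le_add_of_nonneg_right ?_)
    split_ifs <;> norm_num
  by_cases hn' : HasLargeSquare z n
  · rw [sqfTwist_eq_zero hn', mul_zero, zero_sub, norm_neg, if_pos hn', if_neg hm', zero_add]
    exact hb2
  rw [sqfTwist_eq_mul hzy hm hm', sqfTwist_eq_mul hzy hn hn', sub_self, norm_zero, if_neg hm',
    if_neg hn', add_zero]

/-- The local factor at `p` of the product of two shifted twists, minus one. -/
def localShift (ζ₁ ζ₂ : ℂ) (a p n : ℕ) : ℂ :=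
  (if p ∣ n + 1 then ζ₁ - 1 else 0) + if p ∣ n + 1 + a then ζ₂ - 1 else 0

lemma one_add_localShift (ζ₁ ζ₂ : ℂ) {a p : ℕ} (ha : 0 < a) (hap : a < p) (n : ℕ) :
    1 + localShift ζ₁ ζ₂ a p n
      = (if p ∣ n + 1 then ζ₁ else 1) * if p ∣ n + 1 + a then ζ₂ else 1 := by
  rw [localShift]
  by_cases h1 : p ∣ n + 1
  · have h2 : ¬ p ∣ n + 1 + a := fun h =>
      absurd (Nat.le_of_dvd ha ((Nat.dvd_add_right h1).1 h)) (by omega)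
    rw [if_pos h1, if_neg h2, if_pos h1, if_neg h2]
    ring
  · rw [if_neg h1, if_neg h1]
    split_ifs <;> ring

lemma sum_range_ite_dvd_add {M : Type*} [AddCommMonoid M] {p : ℕ} (hp : 0 < p) (c : ℕ) (x : M) :
    ∑ n ∈ range p, (if p ∣ n + c then x else 0) = x := by
  have h1 : #{n ∈ Ico c (c + p) | p ∣ n} = 1 := by
    rw [Nat.filter_Ico_card_eq_of_periodic c p (fun n => p ∣ n) (by intro n; simp),
      Nat.count_eq_card_filter_range]
    have : {n ∈ range p | p ∣ n} = {0} := by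
      ext n
      simp only [mem_filter, mem_range, mem_singleton]
      constructor
      · rintro ⟨h1, h2⟩
        exact Nat.eq_zero_of_dvd_of_lt h2 h1
      · rintro rfl
        exact ⟨hp, dvd_zero p⟩
    rw [this, card_singleton]
  have h2 : ∑ n ∈ range p, (if p ∣ n + c then x else 0)
      = ∑ n ∈ Ico c (c + p), if p ∣ n then x else 0 := by
    rw [sum_Ico_eq_sum_range]
    simp [add_comm]
  rw [h2, ← sum_filter, sum_const, h1, one_smul]

lemma sum_localShift (ζ₁ ζ₂ : ℂ) (a : ℕ) {p : ℕ} (hp : 0 < p) :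
    ∑ n ∈ range p, localShift ζ₁ ζ₂ a p n = (ζ₁ - 1) + (ζ₂ - 1) := by
  simp only [localShift, add_assoc]
  rw [sum_add_distrib, sum_range_ite_dvd_add hp, sum_range_ite_dvd_add hp]

lemma sum_norm_localShift_le {ζ₁ ζ₂ : ℂ} (h1 : ‖ζ₁‖ = 1) (h2 : ‖ζ₂‖ = 1) (a : ℕ) {p : ℕ}
    (hp : 0 < p) : ∑ n ∈ range p, ‖localShift ζ₁ ζ₂ a p n‖ ≤ 4 := by
  have hb : ∀ ζ : ℂ, ‖ζ‖ = 1 → ‖ζ - 1‖ ≤ 2 := fun ζ hζ =>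
    (norm_sub_le _ _).trans (by rw [hζ, norm_one]; norm_num)
  calc _ ≤ ∑ n ∈ range p, ((if p ∣ n + 1 then (2 : ℝ) else 0) + if p ∣ n + (1 + a) then 2 else 0) := by
        refine sum_le_sum fun n _ => ?_
        rw [localShift, add_assoc n 1 a]
        refine (norm_add_le _ _).trans (add_le_add ?_ ?_)
        · split_ifs
          · exact hb _ h1
          · simp
        · split_ifs
          · exact hb _ h2
          · simp
    _ = 4 := by
        rw [sum_add_distrib, sum_range_ite_dvd_add hp, sum_range_ite_dvd_add hp]; norm_num

lemma periodic_localShift (ζ₁ ζ₂ : ℂ) (a p : ℕ) :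
    Function.Periodic (localShift ζ₁ ζ₂ a p) p := by
  intro n
  simp only [localShift]
  rw [show n + p + 1 = n + 1 + p by ring, show n + 1 + p + a = n + 1 + a + p by ring]
  simp only [Nat.dvd_add_self_right]

lemma periodic_smallPart (ζ : ℂ) (z : ℕ) :
    Function.Periodic (smallPart ζ z) (∏ p ∈ primesIoc 0 z, p ^ 2) := by
  intro n
  refine prod_congr rfl fun p hp => ?_
  have h1 : p ^ 2 ∣ ∏ p ∈ primesIoc 0 z, p ^ 2 := dvd_prod_of_mem (fun p => p ^ 2) hp
  have h2 : p ∣ ∏ p ∈ primesIoc 0 z, p ^ 2 := (dvd_pow_self p two_ne_zero).trans h1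
  simp only [(Nat.dvd_add_left h1), (Nat.dvd_add_left h2)]

lemma prod_sq_primesIoc_le (z : ℕ) : ∏ p ∈ primesIoc 0 z, p ^ 2 ≤ 16 ^ z := by
  have : ∏ p ∈ primesIoc 0 z, p = primorial z := by
    rw [primorial]
    refine prod_congr ?_ fun _ _ => rfl
    ext p
    rw [mem_primesIoc (Nat.cast_nonneg z), mem_filter, mem_range]
    constructor
    · rintro ⟨hp, _, h⟩
      exact ⟨Nat.lt_succ_of_le (by exact_mod_cast h), hp⟩
    · rintro ⟨h, hp⟩
      exact ⟨hp, by exact_mod_cast hp.pos, by exact_mod_cast Nat.le_of_lt_succ h⟩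
  rw [prod_pow, this]
  calc _ ≤ (4 ^ z) ^ 2 := Nat.pow_le_pow_left (primorial_le_four_pow z) 2
    _ = _ := by rw [← pow_mul, mul_comm, pow_mul]; norm_num

lemma norm_one_add_le_exp (w : ℂ) : ‖1 + w‖ ≤ Real.exp (w.re + ‖w‖ ^ 2 / 2) := by
  have h1 : ‖1 + w‖ ^ 2 = 1 + (2 * w.re + ‖w‖ ^ 2) := by
    rw [Complex.sq_norm, Complex.sq_norm, Complex.normSq_apply, Complex.normSq_apply]
    simp
    ring
  have h2 : ‖1 + w‖ ^ 2 ≤ Real.exp (w.re + ‖w‖ ^ 2 / 2) ^ 2 := by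
    rw [h1, ← Real.exp_nat_mul, add_comm]
    refine (Real.add_one_le_exp _).trans (le_of_eq ?_)
    congr 1
    push_cast
    ring
  exact le_of_sq_le_sq h2 (Real.exp_pos _).le

/-- The correlation of two truncated twists. -/
theorem norm_sum_sqfTwist_mul_le : ∃ C : ℝ, 0 < C ∧ ∀ (ζ₁ ζ₂ : ℂ) (a z K N : ℕ) (y : ℝ),
    ‖ζ₁‖ = 1 → ‖ζ₂‖ = 1 → 1 ≤ a → a ≤ z → a ≤ N → 5 ≤ z → (z : ℝ) ≤ y →
    ‖∑ n ∈ Icc 1 N, sqfTwist ζ₁ y n * sqfTwist ζ₂ y (n + a)‖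
      ≤ C * N * (Real.exp (-(2 - ζ₁.re - ζ₂.re) * (Real.log (Real.log y) - Real.log z))
          + 24 ^ (K + 1) / (K + 1).factorial + 1 / z)
        + 4 * 16 ^ z * Real.exp ((4 * K + 8) * Real.log y) := by
  obtain ⟨C, hC, hmain⟩ := norm_sum_mul_prod_primes_le
  refine ⟨C + Real.exp 16 + 6, by positivity, ?_⟩
  intro ζ₁ ζ₂ a z K N y h1 h2 ha haz haN hz hzy
  classical
  have hz' : (5 : ℝ) ≤ z := by exact_mod_cast hz
  have hz0 : (0 : ℝ) ≤ z := by linarith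
  set Q := ∏ p ∈ primesIoc 0 z, p ^ 2 with hQ
  have hQpos : 0 < Q := prod_pos fun p hp => by
    rw [mem_primesIoc hz0] at hp
    exact pow_pos hp.1.pos 2
  set h : ℕ → ℂ := fun n => smallPart ζ₁ z (n + 1) * smallPart ζ₂ z (n + 1 + a) with hh
  have hper : Function.Periodic h Q := by
    intro n
    simp only [hh]
    rw [show n + Q + 1 = n + 1 + Q by ring, show n + 1 + Q + a = n + 1 + a + Q by ring,
      periodic_smallPart ζ₁ z, periodic_smallPart ζ₂ z]
  have hh1 : ∀ n, ‖h n‖ ≤ 1 := by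
    intro n
    simp only [hh]
    rw [norm_mul]
    exact mul_le_one₀ (norm_smallPart_le h1 z _) (norm_nonneg _) (norm_smallPart_le h2 z _)
  have hap : ∀ p : ℕ, (z : ℝ) < p → a < p := fun p hp => by
    have : z < p := by exact_mod_cast hp
    omega
  have key := hmain h (localShift ζ₁ ζ₂ a) Q z y K N hQpos hper hh1 hz' hzy (by
    intro p hp hzp
    refine ⟨?_, periodic_localShift ζ₁ ζ₂ a p, sum_norm_localShift_le h1 h2 a hp.pos, fun n => ?_⟩
    · refine Nat.Coprime.prod_left fun q hq => ?_
      rw [mem_primesIoc hz0] at hq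
      refine Nat.Coprime.pow_left 2 ((Nat.coprime_primes hq.1 hp).2 ?_)
      rintro rfl
      linarith [hq.2.2]
    · rw [one_add_localShift ζ₁ ζ₂ ha (hap p hzp) n, norm_mul]
      refine mul_le_one₀ ?_ (norm_nonneg _) ?_
      · split_ifs <;> simp [h1]
      · split_ifs <;> simp [h2])
  set κ : ℝ := 2 - ζ₁.re - ζ₂.re with hκ
  have hre : ∀ ζ : ℂ, ‖ζ‖ = 1 → ζ.re ≤ 1 ∧ -1 ≤ ζ.re := fun ζ hζ => by
    have := abs_le.1 (Complex.abs_re_le_norm ζ)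
    rw [hζ] at this
    exact ⟨this.2, this.1⟩
  have hκ0 : 0 ≤ κ := by linarith [(hre _ h1).1, (hre _ h2).1]
  have hκ4 : κ ≤ 4 := by linarith [(hre _ h1).2, (hre _ h2).2]
  have hprod : ∏ p ∈ primesIoc z y, ‖1 + (∑ n ∈ range p, localShift ζ₁ ζ₂ a p n) / p‖
      ≤ Real.exp 16 * Real.exp (-κ * (Real.log (Real.log y) - Real.log z)) := by
    calc _ ≤ ∏ p ∈ primesIoc z y, Real.exp (-κ * (1 / p) + 8 * (1 / p ^ 2)) := by
          refine prod_le_prod (fun _ _ => norm_nonneg _) fun p hp => ?_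
          rw [mem_primesIoc (hz0.trans hzy)] at hp
          have hp0 : (0 : ℝ) < p := by exact_mod_cast hp.1.pos
          rw [sum_localShift _ _ _ hp.1.pos]
          refine (norm_one_add_le_exp _).trans (Real.exp_le_exp.2 (add_le_add ?_ ?_))
          · rw [Complex.div_natCast_re]
            simp only [Complex.add_re, Complex.sub_re, Complex.one_re]
            apply le_of_eq
            rw [hκ]
            field_simp
            ring
          · rw [norm_div, Complex.norm_natCast]
            have : ‖ζ₁ - 1 + (ζ₂ - 1)‖ ≤ 4 := by
              refine (norm_add_le _ _).trans ?_
              have e1 := norm_sub_le ζ₁ 1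
              have e2 := norm_sub_le ζ₂ 1
              rw [h1, norm_one] at e1
              rw [h2, norm_one] at e2
              linarith
            calc _ ≤ (4 / (p : ℝ)) ^ 2 / 2 := by gcongr
              _ = 8 * (1 / (p : ℝ) ^ 2) := by field_simp; norm_num
      _ = Real.exp (-κ * ∑ p ∈ primesIoc z y, (1 : ℝ) / p
            + 8 * ∑ p ∈ primesIoc z y, (1 : ℝ) / p ^ 2) := by
          rw [← Real.exp_sum, sum_add_distrib, mul_sum, mul_sum]
      _ ≤ _ := by
          rw [← Real.exp_add]
          refine Real.exp_le_exp.2 ?_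
          have e1 := loglog_sub_le_sum_inv_primesIoc (z := z) (y := y) (by linarith) hzy (by linarith)
          have e2 := sum_inv_sq_primesIoc_le (z := z) (y := y) (by linarith)
          have e3 : (2 : ℝ) / z ≤ 2 / 5 := by gcongr
          nlinarith
  have hbad : ∀ c : ℕ, c ≤ N → ∑ n ∈ Icc 1 N, (if HasLargeSquare z (n + c) then (1 : ℝ) else 0)
      ≤ 4 * N / z := by
    intro c hc
    rw [← sum_filter, sum_const, nsmul_eq_mul, mul_one]
    have e1 := card_hasLargeSquare_le (by omega : 1 ≤ z) (N + c)
    have e2 : #{n ∈ Icc 1 N | HasLargeSquare z (n + c)} ≤ #{n ∈ Ioc 0 (N + c) | HasLargeSquare z n} := by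
      refine card_le_card_of_injOn (fun n => n + c) ?_ (fun x _ y _ hxy => by simpa using hxy)
      intro n hn
      simp only [coe_filter, mem_Icc, Set.mem_ofPred_eq, mem_Ioc] at hn ⊢
      exact ⟨⟨by omega, by omega⟩, hn.2⟩
    calc _ ≤ (#{n ∈ Ioc 0 (N + c) | HasLargeSquare z n} : ℝ) := by exact_mod_cast e2
      _ ≤ _ := e1
      _ ≤ 2 * (N + N) / z := by push_cast; gcongr
      _ = _ := by ring
  have hsum : ∑ n ∈ Icc 1 N, (smallPart ζ₁ z n * largePart ζ₁ z y n) *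
        (smallPart ζ₂ z (n + a) * largePart ζ₂ z y (n + a))
      = ∑ n ∈ range N, h n * ∏ p ∈ primesIoc z y, (1 + localShift ζ₁ ζ₂ a p n) := by
    rw [← Ico_add_one_right_eq_Icc, sum_Ico_eq_sum_range]
    refine sum_congr (by simp) fun n _ => ?_
    have : ∏ p ∈ primesIoc z y, (1 + localShift ζ₁ ζ₂ a p n)
        = largePart ζ₁ z y (n + 1) * largePart ζ₂ z y (n + 1 + a) := by
      rw [largePart, largePart, ← prod_mul_distrib]
      refine prod_congr rfl fun p hp => ?_
      rw [mem_primesIoc (hz0.trans hzy)] at hp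
      exact one_add_localShift ζ₁ ζ₂ ha (hap p hp.2.1) n
    rw [this, add_comm 1 n]
    simp only [hh]
    ring
  have hdiff : ‖∑ n ∈ Icc 1 N, sqfTwist ζ₁ y n * sqfTwist ζ₂ y (n + a)
      - ∑ n ∈ Icc 1 N, (smallPart ζ₁ z n * largePart ζ₁ z y n) *
        (smallPart ζ₂ z (n + a) * largePart ζ₂ z y (n + a))‖ ≤ 4 * N / z + 4 * N / z := by
    rw [← sum_sub_distrib]
    refine (norm_sum_le_of_le _ fun n hn => norm_sqfTwist_mul_sub_le h1 h2 hzy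
      (by have := (mem_Icc.1 hn).1; omega) (by have := (mem_Icc.1 hn).1; omega)).trans ?_
    rw [sum_add_distrib]
    exact add_le_add (hbad 0 (Nat.zero_le _)) (hbad a haN)
  rw [hsum] at hdiff
  have hfin := (norm_sub_norm_le _ _).trans hdiff
  have hQ16 : (Q : ℝ) ≤ 16 ^ z := by exact_mod_cast prod_sq_primesIoc_le z
  have hN0 : (0 : ℝ) ≤ N := Nat.cast_nonneg N
  set X := Real.exp (-κ * (Real.log (Real.log y) - Real.log z)) with hX
  set η : ℝ := 24 ^ (K + 1) / (K + 1).factorial with hη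
  have hX0 : 0 ≤ X := (Real.exp_pos _).le
  have hη0 : 0 ≤ η := by positivity
  have hrem : 4 * (Q : ℝ) * Real.exp ((4 * K + 8) * Real.log y)
      ≤ 4 * 16 ^ z * Real.exp ((4 * K + 8) * Real.log y) := by gcongr
  have hm2 : (N : ℝ) * (∏ p ∈ primesIoc z y, ‖1 + (∑ n ∈ range p, localShift ζ₁ ζ₂ a p n) / p‖ + C * η)
      ≤ N * (Real.exp 16 * X + C * η) := by gcongr
  have hz1 : 0 ≤ 1 / (z : ℝ) := by positivity
  have e4 : 4 * (N : ℝ) / z = 4 * (N * (1 / z)) := by ring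
  have g1 : 0 ≤ N * X := by positivity
  have g2 : 0 ≤ N * η := by positivity
  have g3 : 0 ≤ N * (1 / (z : ℝ)) := by positivity
  have g4 := (Real.exp_pos 16)
  have g5 : (8:ℝ) ≤ Real.exp 16 := by linarith [Real.add_one_le_exp (16 : ℝ)]
  calc _ ≤ N * (Real.exp 16 * X + C * η) + 8 * (N * (1 / z))
        + 4 * 16 ^ z * Real.exp ((4 * K + 8) * Real.log y) := by linarith
    _ ≤ _ := by
        have i1 := mul_nonneg hC.le g1
        have i2 := mul_nonneg g4.le g2
        have i3 := mul_nonneg hC.le g3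
        have i4 := mul_le_mul_of_nonneg_right g5 g3
        ring_nf at *
        linarith

open Filter

/-! ### Asymptotic bounds -/

lemma pow_div_factorial_le_exp_neg {β : ℝ} (hβ : Real.exp 200 ≤ β) {m : ℕ} (hm : β / 16 ≤ m) :
    (24 : ℝ) ^ m / m.factorial ≤ Real.exp (-(1 / 21) * β * Real.log β) := by
  have hβ0 : 0 < β := (Real.exp_pos _).trans_le hβ
  have hm0 : (0 : ℝ) < m := by linarith
  have hlogβ : 200 ≤ Real.log β := (Real.le_log_iff_exp_le hβ0).2 hβ
  have hl16 : Real.log 16 ≤ 15 := by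
    linarith [Real.log_le_sub_one_of_pos (show (0 : ℝ) < 16 by norm_num)]
  have hl24 : Real.log 24 ≤ 23 := by
    linarith [Real.log_le_sub_one_of_pos (show (0 : ℝ) < 24 by norm_num)]
  have hlogm : Real.log β - 15 ≤ Real.log m := by
    have := Real.log_le_log (by positivity) hm
    rw [Real.log_div hβ0.ne' (by norm_num)] at this
    linarith
  have hf : (0 : ℝ) < m.factorial := by exact_mod_cast m.factorial_pos
  have h1 := Real.pow_div_factorial_le_exp (m : ℝ) hm0.le m
  have hmm : (0 : ℝ) < (m : ℝ) ^ m := by positivity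
  have h2 : (24 : ℝ) ^ m / m.factorial ≤ Real.exp (m * (Real.log 24 + 1 - Real.log m)) := by
    have e1 : (24 : ℝ) ^ m = Real.exp (m * Real.log 24) := by
      rw [Real.exp_nat_mul, Real.exp_log (by norm_num)]
    have e2 : (m : ℝ) ^ m = Real.exp (m * Real.log m) := by
      rw [Real.exp_nat_mul, Real.exp_log hm0]
    have e3 : Real.exp (m * (Real.log 24 + 1 - Real.log m))
        = Real.exp (m * Real.log 24) * Real.exp m / Real.exp (m * Real.log m) := by
      rw [← Real.exp_add, ← Real.exp_sub]; congr 1; ring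
    rw [e3, ← e1, ← e2, div_le_div_iff₀ hf hmm, mul_assoc]
    gcongr
    rwa [div_le_iff₀ hf] at h1
  refine h2.trans (Real.exp_le_exp.2 ?_)
  have h3 : Real.log 24 + 1 - Real.log m ≤ 39 - Real.log β := by linarith
  have h4 : 39 - Real.log β ≤ 0 := by linarith
  nlinarith

lemma eventually_log_log (P : ℝ → Prop) (h : ∀ᶠ t in atTop, P t) :
    ∀ᶠ x in atTop, P (Real.log (Real.log x)) :=
  (Real.tendsto_log_atTop.comp Real.tendsto_log_atTop).eventually h

lemma eventually_log_le_div (c : ℝ) (hc : 0 < c) : ∀ᶠ t in atTop, Real.log t ≤ t / c := by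
  filter_upwards [Real.isLittleO_log_id_atTop.bound (inv_pos.2 hc), eventually_ge_atTop 1] with t ht h1
  simp only [id, Real.norm_eq_abs] at ht
  rw [abs_of_nonneg (Real.log_nonneg h1), abs_of_nonneg (by linarith)] at ht
  rwa [div_eq_inv_mul]

/-- The growth conditions on `x` used below. -/
lemma eventually_growth (c : ℝ) : ∀ᶠ x in atTop, c ≤ Real.log (Real.log x) ∧
    Real.log (Real.log (Real.log x)) ≤ Real.log (Real.log x) / 16 ∧
    Real.log (Real.log x) ≤ √(Real.log x) / 8 ∧ 4 ≤ Real.log x ∧ c ≤ x ∧ 1 ≤ x := by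
  have h1 := (Real.tendsto_sqrt_atTop.comp Real.tendsto_log_atTop).eventually
    (eventually_log_le_div 16 (by norm_num))
  filter_upwards [eventually_log_log _ (eventually_ge_atTop c),
    eventually_log_log _ (eventually_log_le_div 16 (by norm_num)), h1,
    Real.tendsto_log_atTop.eventually (eventually_ge_atTop 4), eventually_ge_atTop c,
    eventually_ge_atTop 1] with x a1 a2 a3 a4 a5 a6
  refine ⟨a1, a2, ?_, a4, a5, a6⟩
  simp only [Function.comp] at a3
  rw [Real.log_sqrt (by linarith)] at a3
  linarith

lemma pow_mul_exp_le {x l r : ℝ} {z : ℕ} (hx : 0 < x) (hl : 0 < l) (hz : (z : ℝ) ≤ 2 * l)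
    (hr : r ≤ Real.log x / 2) (h : 3 * (2 * l) + Real.log x / 2 ≤ Real.log x - Real.log l) :
    (16 : ℝ) ^ z * Real.exp r ≤ x * (1 / l) := by
  have h16 : (16 : ℝ) ^ z ≤ Real.exp (3 * (2 * l)) := by
    calc (16 : ℝ) ^ z ≤ (Real.exp 3) ^ z := by
          gcongr
          have e5 : Real.exp 3 = Real.exp 1 ^ 3 := by rw [← Real.exp_nat_mul]; norm_num
          have e6 := Real.exp_one_gt_d9
          rw [e5]
          calc (16 : ℝ) ≤ 2.7 ^ 3 := by norm_num
            _ ≤ _ := by gcongr; linarith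
      _ = Real.exp (3 * z) := by rw [← Real.exp_nat_mul]; congr 1; ring
      _ ≤ _ := by gcongr
  have hl1 : 1 / l = Real.exp (-Real.log l) := by
    rw [Real.exp_neg, Real.exp_log hl, one_div]
  calc (16 : ℝ) ^ z * Real.exp r
      ≤ Real.exp (3 * (2 * l)) * Real.exp (Real.log x / 2) := by gcongr
    _ = Real.exp (3 * (2 * l) + Real.log x / 2) := by rw [← Real.exp_add]
    _ ≤ Real.exp (Real.log x - Real.log l) := Real.exp_le_exp.2 h
    _ = x * (1 / l) := by rw [hl1, sub_eq_add_neg, Real.exp_add, Real.exp_log hx]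

theorem norm_sum_sqfTwist_mul_le_of_log_sqrt_le : ∃ C : ℝ, 0 < C ∧ ∀ a : ℕ, 1 ≤ a →
    ∀ᶠ x : ℝ in atTop, ∀ (ζ₁ ζ₂ : ℂ) (y β : ℝ), ‖ζ₁‖ = 1 → ‖ζ₂‖ = 1 → 0 < y →
    β = Real.log x / Real.log y → Real.exp 200 ≤ β → √(Real.log x) ≤ Real.log y →
    ‖∑ n ∈ Icc 1 ⌊x⌋₊, sqfTwist ζ₁ y n * sqfTwist ζ₂ y (n + a)‖
      ≤ C * x * (Real.exp (-(2 - ζ₁.re - ζ₂.re) *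
            (Real.log (Real.log y) - Real.log (Real.log (Real.log x))))
          + Real.exp (-(1 / 21) * β * Real.log β) + 1 / Real.log (Real.log x)) := by
  obtain ⟨C, hC, hmain⟩ := norm_sum_sqfTwist_mul_le
  refine ⟨C * Real.exp 4 + 4, by positivity, fun a ha => ?_⟩
  filter_upwards [eventually_growth (max 5 a)] with x hx ζ₁ ζ₂ y β h1 h2 hy hβ hβ0 hxy
  obtain ⟨g1, g2, g3, g4, g5, g6⟩ := hx
  set L := Real.log x with hL
  set l := Real.log L with hl
  have hl5 : 5 ≤ l := (le_max_left _ _).trans g1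
  have hla : (a : ℝ) ≤ l := (le_max_right _ _).trans g1
  have hl0 : 0 < l := by linarith
  have hx0 : 0 < x := by linarith
  have hs : √L * √L = L := Real.mul_self_sqrt (by linarith)
  have hs2 : 2 ≤ √L := Real.le_sqrt_of_sq_le (by norm_num; linarith)
  set z := ⌈l⌉₊ with hz
  have hz1 : l ≤ z := Nat.le_ceil l
  have hz2 : (z : ℝ) ≤ 2 * l := by linarith [Nat.ceil_lt_add_one hl0.le]
  have hz5 : 5 ≤ z := by exact_mod_cast hl5.trans hz1
  have hz0 : (0 : ℝ) < z := by linarith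
  have haz : a ≤ z := by exact_mod_cast hla.trans hz1
  have hlogy : 0 < Real.log y := by linarith
  have hzy : (z : ℝ) ≤ y := by
    calc (z : ℝ) ≤ √L + 1 := by linarith
      _ ≤ Real.exp (√L) := Real.add_one_le_exp _
      _ ≤ y := by rw [← Real.exp_log hy]; exact Real.exp_le_exp.2 hxy
  set K := ⌊β / 16⌋₊ with hK
  have hβpos : 0 < β := (Real.exp_pos _).trans_le hβ0
  have hβ32 : 32 ≤ β := by linarith [Real.add_one_le_exp (200 : ℝ)]
  have hK1 : (K : ℝ) ≤ β / 16 := Nat.floor_le (by positivity)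
  have hK2 : β / 16 ≤ (K + 1 : ℕ) := by push_cast; exact (Nat.lt_floor_add_one _).le
  have key := hmain ζ₁ ζ₂ a z K ⌊x⌋₊ y h1 h2 ha haz
    (Nat.le_floor ((le_max_right _ _).trans g5)) hz5 hzy
  refine key.trans ?_
  have hre : ∀ ζ : ℂ, ‖ζ‖ = 1 → ζ.re ≤ 1 ∧ -1 ≤ ζ.re := fun ζ hζ => by
    have := abs_le.1 (Complex.abs_re_le_norm ζ)
    rw [hζ] at this
    exact ⟨this.2, this.1⟩
  set κ : ℝ := 2 - ζ₁.re - ζ₂.re with hκ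
  have hκ0 : 0 ≤ κ := by linarith [(hre _ h1).1, (hre _ h2).1]
  have hκ4 : κ ≤ 4 := by linarith [(hre _ h1).2, (hre _ h2).2]
  have e1 : Real.exp (-κ * (Real.log (Real.log y) - Real.log z))
      ≤ Real.exp 4 * Real.exp (-κ * (Real.log (Real.log y) - Real.log l)) := by
    rw [← Real.exp_add]
    refine Real.exp_le_exp.2 ?_
    have : Real.log z ≤ Real.log l + 1 := by
      have h3 := Real.log_le_log hz0 hz2
      rw [Real.log_mul (by norm_num) hl0.ne'] at h3
      linarith [Real.log_le_sub_one_of_pos (show (0 : ℝ) < 2 by norm_num)]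
    nlinarith
  have e2 := pow_div_factorial_le_exp_neg hβ0 hK2
  have e3 : 1 / (z : ℝ) ≤ 1 / l := one_div_le_one_div_of_le hl0 hz1
  have hL2 : β * Real.log y = L := by rw [hβ]; field_simp
  have h8 : (4 * K + 8) * Real.log y ≤ L / 2 := by
    rw [← hL2, mul_comm β, mul_div_assoc, mul_comm]
    exact mul_le_mul_of_nonneg_left (by linarith) hlogy.le
  have e4 : 4 * 16 ^ z * Real.exp ((4 * K + 8) * Real.log y) ≤ 4 * (x * (1 / l)) := by
    have h9 : √L * 2 ≤ L := by
      conv_rhs => rw [← hs]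
      exact mul_le_mul_of_nonneg_left hs2 (by linarith)
    have := pow_mul_exp_le hx0 hl0 hz2 h8 (by linarith)
    linarith
  have hfl : (⌊x⌋₊ : ℝ) ≤ x := Nat.floor_le hx0.le
  set E1 := Real.exp (-κ * (Real.log (Real.log y) - Real.log l)) with hE1
  set E2 := Real.exp (-(1 / 21) * β * Real.log β) with hE2
  have p1 : 0 ≤ E1 := (Real.exp_pos _).le
  have p2 : 0 ≤ E2 := (Real.exp_pos _).le
  have p3 : 0 ≤ 1 / l := by positivity
  have p4 : 1 ≤ Real.exp 4 := Real.one_le_exp (by norm_num)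
  calc _ ≤ C * x * (Real.exp 4 * E1 + Real.exp 4 * E2 + Real.exp 4 * (1 / l))
        + 4 * (x * (E1 + E2 + 1 / l)) := by
        refine add_le_add ?_ (e4.trans ?_)
        · gcongr
          · exact e2.trans (le_mul_of_one_le_left p2 p4)
          · exact e3.trans (le_mul_of_one_le_left p3 p4)
        · gcongr
          linarith
    _ = _ := by ring

/-! ### Truncated Möbius functions -/

lemma iterLog_two (x : ℝ) : iterLog 2 x = Real.log (Real.log x) := rfl

lemma muTrunc_cast (y : ℝ) (n : ℕ) : ((muTrunc y n : ℤ) : ℂ) = sqfTwist (-1) y n := by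
  simp [muTrunc, sqfTwist]

lemma eventually_B_le : ∀ᶠ x in atTop, B x ≤ Real.log (Real.log x) / 2 := by
  have h4 : Tendsto (fun x => Real.log (Real.log (Real.log (Real.log x)))) atTop atTop :=
    Real.tendsto_log_atTop.comp (Real.tendsto_log_atTop.comp
      (Real.tendsto_log_atTop.comp Real.tendsto_log_atTop))
  have h3 : Tendsto (fun x => Real.log (Real.log (Real.log x))) atTop atTop :=
    Real.tendsto_log_atTop.comp (Real.tendsto_log_atTop.comp Real.tendsto_log_atTop)
  filter_upwards [h4.eventually_ge_atTop 1, h3.eventually_ge_atTop 1,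
    eventually_log_log _ (eventually_ge_atTop 4)] with x e4 e3 e2
  have hB : B x = √(Real.log (Real.log x)) /
    (Real.log (Real.log (Real.log x)) * Real.log (Real.log (Real.log (Real.log x))) ^ 2) := rfl
  set l := Real.log (Real.log x)
  have hs : √l * √l = l := Real.mul_self_sqrt (by linarith)
  have hs2 : 2 ≤ √l := Real.le_sqrt_of_sq_le (by norm_num; linarith)
  rw [hB]
  refine (div_le_self (by positivity) ?_).trans (by nlinarith)
  exact one_le_mul_of_one_le_of_one_le e3 (one_le_pow₀ e4)

lemma norm_sum_sqfTwist_mul_le_self {ζ₁ ζ₂ : ℂ} (h1 : ‖ζ₁‖ = 1) (h2 : ‖ζ₂‖ = 1) (a : ℕ)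
    {x : ℝ} (hx : 0 ≤ x) (y : ℝ) :
    ‖∑ n ∈ Icc 1 ⌊x⌋₊, sqfTwist ζ₁ y n * sqfTwist ζ₂ y (n + a)‖ ≤ x := by
  calc _ ≤ ∑ n ∈ Icc 1 ⌊x⌋₊, (1 : ℝ) := norm_sum_le_of_le _ fun n _ => by
        rw [norm_mul]
        exact mul_le_one₀ (norm_sqfTwist_le h1 y n) (norm_nonneg _) (norm_sqfTwist_le h2 y _)
    _ ≤ x := by simpa using Nat.floor_le hx

theorem abs_sum_muTrunc_mul_le : ∃ x₀ : ℝ, ∀ a : ℕ, 1 ≤ a → ∃ C : ℝ, 0 < C ∧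
    ∀ x y β : ℝ, x₀ ≤ x → 2 ≤ y → y ≤ x →
      β = Real.log x / Real.log y → β ≤ Real.exp (B x) →
        |∑ n ∈ Finset.Icc 1 ⌊x⌋₊, ((muTrunc y n * muTrunc y (n + a) : ℤ) : ℝ)|
          ≤ C * (x * (1 / iterLog 2 y + Real.exp (-(1 / 21) * β * Real.log β))) := by
  obtain ⟨C, hC, hcore⟩ := norm_sum_sqfTwist_mul_le_of_log_sqrt_le
  obtain ⟨x₀, hx₀⟩ := eventually_atTop.1 ((eventually_growth 5).and eventually_B_le)
  refine ⟨x₀, fun a ha => ?_⟩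
  obtain ⟨X, hX⟩ := eventually_atTop.1 (hcore a ha)
  set b : ℝ := Real.exp 200 with hb
  refine ⟨2 * C + Real.exp ((1 / 21) * b * Real.log b) + |Real.log (Real.log X)|, by positivity, ?_⟩
  intro x y β hx hy hyx hβ hβB
  obtain ⟨⟨g1, g2, g3, g4, g5, g6⟩, gB⟩ := hx₀ x hx
  have hcast : |∑ n ∈ Finset.Icc 1 ⌊x⌋₊, ((muTrunc y n * muTrunc y (n + a) : ℤ) : ℝ)|
      = ‖∑ n ∈ Icc 1 ⌊x⌋₊, sqfTwist (-1) y n * sqfTwist (-1) y (n + a)‖ := by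
    rw [← Real.norm_eq_abs, ← Complex.norm_real]
    congr 1
    push_cast
    simp only [muTrunc_cast]
  rw [hcast, iterLog_two]
  set L := Real.log x with hL
  set l := Real.log L with hl
  have hl0 : 0 < l := by linarith
  have hL0 : 0 < L := by linarith
  have hx0 : 0 < x := by linarith
  have hlogy : 0 < Real.log y := Real.log_pos (by linarith)
  have hlogyx : Real.log y ≤ L := Real.log_le_log (by linarith) hyx
  have hβ1 : 1 ≤ β := by rw [hβ, one_le_div hlogy]; exact hlogyx
  have hβ0 : 0 < β := by linarith
  have hsq : √L = Real.exp (l / 2) := by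
    rw [Real.sqrt_eq_rpow, Real.rpow_def_of_pos hL0]; congr 1; rw [← hl]; ring
  have hyβ : Real.log y = L / β := by rw [hβ]; field_simp
  have hxy : √L ≤ Real.log y := by
    have h2 : β ≤ √L := hβB.trans (by rw [hsq]; exact Real.exp_le_exp.2 gB)
    rw [hyβ, le_div_iff₀ hβ0]
    calc _ ≤ √L * √L := by gcongr
      _ = L := Real.mul_self_sqrt hL0.le
  have hly : l / 2 ≤ Real.log (Real.log y) := by
    rw [Real.le_log_iff_exp_le hlogy, ← hsq]; exact hxy
  have hly0 : 0 < Real.log (Real.log y) := by linarith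
  have hlyl : Real.log (Real.log y) ≤ l := Real.log_le_log hlogy hlogyx
  set E := Real.exp (-(1 / 21) * β * Real.log β) with hE
  have hE0 : 0 < E := Real.exp_pos _
  have hd0 : 0 < 1 / Real.log (Real.log y) := by positivity
  have htriv := norm_sum_sqfTwist_mul_le_self (ζ₁ := -1) (ζ₂ := -1) (by simp) (by simp) a hx0.le y
  set S := ‖∑ n ∈ Icc 1 ⌊x⌋₊, sqfTwist (-1) y n * sqfTwist (-1) y (n + a)‖ with hS
  have hc1 : 0 < Real.exp ((1 / 21) * b * Real.log b) := Real.exp_pos _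
  have hc2 : 0 ≤ |Real.log (Real.log X)| := abs_nonneg _
  have hT : 0 ≤ x * (1 / Real.log (Real.log y) + E) := by positivity
  rcases lt_or_ge β b with hβb | hβb
  · have h3 : 1 ≤ Real.exp ((1 / 21) * b * Real.log b) * E := by
      rw [hE, ← Real.exp_add]
      refine Real.one_le_exp ?_
      have h4 : Real.log β ≤ Real.log b := Real.log_le_log hβ0 hβb.le
      have h5 : 0 ≤ Real.log β := Real.log_nonneg hβ1
      have := mul_le_mul hβb.le h4 h5 (by positivity : (0 : ℝ) ≤ b)
      linarith
    calc S ≤ x * 1 := by linarith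
      _ ≤ x * (Real.exp ((1 / 21) * b * Real.log b) * E) := by gcongr
      _ = Real.exp ((1 / 21) * b * Real.log b) * (x * (0 + E)) := by ring
      _ ≤ _ := by gcongr; linarith
  rcases lt_or_ge x X with hxX | hxX
  · have h3 : 1 ≤ |Real.log (Real.log X)| * (1 / Real.log (Real.log y)) := by
      rw [mul_one_div, one_le_div hly0]
      refine (hlyl.trans ?_).trans (le_abs_self _)
      exact Real.log_le_log hL0 (Real.log_le_log hx0 hxX.le)
    calc S ≤ x * 1 := by linarith
      _ ≤ x * (|Real.log (Real.log X)| * (1 / Real.log (Real.log y))) := by gcongr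
      _ = |Real.log (Real.log X)| * (x * (1 / Real.log (Real.log y) + 0)) := by ring
      _ ≤ _ := by gcongr; linarith
  have key := hX x hxX (-1) (-1) y β (by simp) (by simp) (by linarith) hβ hβb hxy
  rw [← hS] at key
  have h5 : 1 / l ≤ 1 / Real.log (Real.log y) := one_div_le_one_div_of_le hly0 hlyl
  have h6 : Real.exp (-(2 - (-1 : ℂ).re - (-1 : ℂ).re) * (Real.log (Real.log y) - Real.log l))
      ≤ 1 / l := by
    have : 1 / l = Real.exp (-Real.log l) := by rw [Real.exp_neg, Real.exp_log hl0, one_div]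
    rw [this]
    refine Real.exp_le_exp.2 ?_
    simp only [Complex.neg_re, Complex.one_re]
    linarith
  calc S ≤ _ := key
    _ ≤ C * x * (1 / Real.log (Real.log y) + E + 1 / Real.log (Real.log y)) := by
        gcongr
        exact h6.trans h5
    _ ≤ C * x * (2 * (1 / Real.log (Real.log y) + E)) := by gcongr; linarith
    _ = (2 * C) * (x * (1 / Real.log (Real.log y) + E)) := by ring
    _ ≤ _ := by gcongr; linarith

/-! ### Twists by `e^{iuω(n)}` -/

lemma sum_inv_primesIoc_le_of_rpow_le {y X : ℝ} (hy : 1 ≤ y) (hyX : y ≤ X) {J : ℕ}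
    (h : X ^ ((1 / 2 : ℝ) ^ J) ≤ y) : ∑ p ∈ primesIoc y X, (1 : ℝ) / p ≤ 6 * J := by
  have h1 := sum_primeBlock (fun p : ℕ => (1 : ℝ) / p) (by linarith : 0 ≤ y) (hy.trans hyX) hyX J
  rw [show sqrtSeq y X J = y from max_eq_left h] at h1
  rw [← h1]
  calc _ ≤ ∑ j ∈ range J, (6 : ℝ) := sum_le_sum fun j _ =>
        sum_inv_primeBlock_le (by linarith) (hy.trans hyX) j
    _ = 6 * J := by simp [mul_comm]

lemma sum_inv_primesIoc_le_log {y X γ : ℝ} (hy : 1 < y) (hyX : y ≤ X)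
    (hγ : Real.log X ≤ γ * Real.log y) :
    ∑ p ∈ primesIoc y X, (1 : ℝ) / p ≤ 6 * (2 * Real.log γ + 1) := by
  have hlogy : 0 < Real.log y := Real.log_pos hy
  have hlogX : Real.log y ≤ Real.log X := Real.log_le_log (by linarith) hyX
  have hγ1 : 1 ≤ γ := by
    by_contra hc
    push Not at hc
    nlinarith
  have hX0 : 0 < X := by linarith
  have hl2 := Real.log_two_gt_d9
  have hlγ : 0 ≤ Real.log γ := Real.log_nonneg hγ1
  set J := ⌈2 * Real.log γ⌉₊ with hJ
  have hJ1 : 2 * Real.log γ ≤ J := Nat.le_ceil _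
  have hJ2 : (J : ℝ) < 2 * Real.log γ + 1 := Nat.ceil_lt_add_one (by linarith)
  have hpow : γ ≤ 2 ^ J := by
    rw [← Real.log_le_log_iff (by linarith) (by positivity), Real.log_pow]
    nlinarith
  refine (sum_inv_primesIoc_le_of_rpow_le (J := J) hy.le hyX ?_).trans (by linarith)
  rw [← Real.log_le_log_iff (Real.rpow_pos_of_pos hX0 _) (by linarith), Real.log_rpow hX0, one_div,
    inv_pow, inv_mul_le_iff₀ (by positivity)]
  calc _ ≤ γ * Real.log y := hγ
    _ ≤ _ := by gcongr

lemma norm_pow_sub_one_le {ζ : ℂ} (hζ : ‖ζ‖ = 1) (k : ℕ) : ‖ζ ^ k - 1‖ ≤ k * ‖ζ - 1‖ := by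
  induction k with
  | zero => simp
  | succ k ih =>
    calc ‖ζ ^ (k + 1) - 1‖ = ‖ζ * (ζ ^ k - 1) + (ζ - 1)‖ := by congr 1; ring
      _ ≤ ‖ζ‖ * ‖ζ ^ k - 1‖ + ‖ζ - 1‖ := by rw [← norm_mul]; exact norm_add_le _ _
      _ ≤ 1 * (k * ‖ζ - 1‖) + ‖ζ - 1‖ := by rw [hζ]; gcongr
      _ = _ := by push_cast; ring

/-- The unit complex number `e^{iu}`. -/
def unitExp (u : ℝ) : ℂ := Complex.exp (Complex.I * u)

lemma norm_unitExp (u : ℝ) : ‖unitExp u‖ = 1 := Complex.norm_exp_I_mul_ofReal u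

lemma unitExp_re (u : ℝ) : (unitExp u).re = Real.cos u := by
  rw [unitExp, mul_comm, Complex.exp_ofReal_mul_I_re]

lemma norm_unitExp_sub_one_le (u : ℝ) : ‖unitExp u - 1‖ ≤ |u| :=
  Real.norm_exp_I_mul_ofReal_sub_one_le

lemma muTwist_eq (u : ℝ) (n : ℕ) :
    muTwist u n = ((ArithmeticFunction.moebius n ^ 2 : ℤ) : ℂ) *
      unitExp u ^ #n.primeFactors := by
  rw [muTwist, unitExp, ← Complex.exp_nat_mul, ArithmeticFunction.cardDistinctFactors_apply]
  congr 2
  rw [mul_comm]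
  rfl

lemma norm_moebius_sq_le (n : ℕ) : ‖((ArithmeticFunction.moebius n ^ 2 : ℤ) : ℂ)‖ ≤ 1 := by
  by_cases h : Squarefree n
  · rw [moebius_sq_eq_one h]; simp
  · rw [moebius_sq_eq_zero h]; simp

lemma norm_muTwist_le (u : ℝ) (n : ℕ) : ‖muTwist u n‖ ≤ 1 := by
  rw [muTwist_eq, norm_mul, norm_pow, norm_unitExp, one_pow, mul_one]
  exact norm_moebius_sq_le n

/-- The number of prime factors of `n` larger than `y`. -/
def omegaLarge (y : ℝ) (n : ℕ) : ℕ := #(n.primeFactors.filter fun p : ℕ => ¬ (p : ℝ) ≤ y)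

lemma norm_muTwist_sub_sqfTwist_le (u y : ℝ) (n : ℕ) :
    ‖muTwist u n - sqfTwist (unitExp u) y n‖ ≤ |u| * omegaLarge y n := by
  have h1 : #n.primeFactors = omegaTrunc y n + omegaLarge y n :=
    (card_filter_add_card_filter_not _).symm
  rw [muTwist_eq, sqfTwist, ← mul_sub, h1, pow_add, norm_mul]
  calc _ ≤ 1 * ‖unitExp u ^ omegaTrunc y n * unitExp u ^ omegaLarge y n
        - unitExp u ^ omegaTrunc y n‖ := by gcongr; exact norm_moebius_sq_le n
    _ = ‖unitExp u ^ omegaTrunc y n * (unitExp u ^ omegaLarge y n - 1)‖ := by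
        rw [one_mul, mul_sub, mul_one]
    _ = ‖unitExp u ^ omegaLarge y n - 1‖ := by
        rw [norm_mul, norm_pow, norm_unitExp, one_pow, one_mul]
    _ ≤ omegaLarge y n * ‖unitExp u - 1‖ := norm_pow_sub_one_le (norm_unitExp u) _
    _ ≤ omegaLarge y n * |u| := by gcongr; exact norm_unitExp_sub_one_le u
    _ = _ := mul_comm _ _

lemma sum_omegaLarge_le (y : ℝ) (M : ℕ) :
    ∑ n ∈ Ioc 0 M, (omegaLarge y n : ℝ) ≤ M * ∑ p ∈ primesIoc y M, (1 : ℝ) / p := by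
  have h1 : ∀ n ∈ Ioc 0 M, (omegaLarge y n : ℝ) = ∑ p ∈ primesIoc y M, if p ∣ n then (1 : ℝ) else 0 := by
    intro n hn
    rw [mem_Ioc] at hn
    rw [← sum_filter, sum_const, nsmul_eq_mul, mul_one, omegaLarge]
    congr 2
    ext p
    rw [mem_filter, mem_filter, mem_primesIoc (Nat.cast_nonneg M), Nat.mem_primeFactors, not_le]
    constructor
    · rintro ⟨⟨h1, h2, _⟩, h3⟩
      exact ⟨⟨h1, h3, by exact_mod_cast (Nat.le_of_dvd hn.1 h2).trans hn.2⟩, h2⟩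
    · rintro ⟨⟨h1, h3, _⟩, h2⟩
      exact ⟨⟨h1, h2, hn.1.ne'⟩, h3⟩
  rw [sum_congr rfl h1, sum_comm, mul_sum]
  refine sum_le_sum fun p _ => ?_
  rw [← sum_filter, sum_const, Nat.Ioc_filter_dvd_card_eq_div, nsmul_eq_mul, mul_one]
  exact Nat.cast_div_le.trans (le_of_eq (by ring))

lemma sum_omegaLarge_add_le (y : ℝ) {N c : ℕ} (hc : c ≤ N) :
    ∑ n ∈ Icc 1 N, (omegaLarge y (n + c) : ℝ)
      ≤ (2 * N : ℕ) * ∑ p ∈ primesIoc y (2 * N : ℕ), (1 : ℝ) / p := by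
  refine le_trans ?_ (sum_omegaLarge_le y (2 * N))
  have h1 : ∑ n ∈ Icc 1 N, (omegaLarge y (n + c) : ℝ)
      = ∑ n ∈ (Icc 1 N).map (addRightEmbedding c), (omegaLarge y n : ℝ) := by
    rw [sum_map]; rfl
  rw [h1]
  refine sum_le_sum_of_subset_of_nonneg ?_ fun _ _ _ => Nat.cast_nonneg _
  intro n hn
  obtain ⟨m, hm, rfl⟩ := mem_map.1 hn
  rw [mem_Icc] at hm
  simp only [addRightEmbedding_apply, mem_Ioc]
  omega

lemma norm_sum_muTwist_sub_le (u v y : ℝ) {N a : ℕ} (ha : a ≤ N) :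
    ‖∑ n ∈ Icc 1 N, muTwist u n * muTwist v (n + a)
        - ∑ n ∈ Icc 1 N, sqfTwist (unitExp u) y n * sqfTwist (unitExp v) y (n + a)‖
      ≤ max |u| |v| * (4 * N * ∑ p ∈ primesIoc y (2 * N : ℕ), (1 : ℝ) / p) := by
  set w := max |u| |v| with hw
  have hpt : ∀ n : ℕ, ‖muTwist u n * muTwist v (n + a)
      - sqfTwist (unitExp u) y n * sqfTwist (unitExp v) y (n + a)‖
      ≤ w * omegaLarge y (n + 0) + w * omegaLarge y (n + a) := by
    intro n
    have e1 := norm_muTwist_sub_sqfTwist_le u y n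
    have e2 := norm_muTwist_sub_sqfTwist_le v y (n + a)
    calc _ = ‖(muTwist u n - sqfTwist (unitExp u) y n) * muTwist v (n + a)
          + sqfTwist (unitExp u) y n * (muTwist v (n + a) - sqfTwist (unitExp v) y (n + a))‖ := by
          congr 1; ring
      _ ≤ ‖muTwist u n - sqfTwist (unitExp u) y n‖ * ‖muTwist v (n + a)‖
          + ‖sqfTwist (unitExp u) y n‖ * ‖muTwist v (n + a) - sqfTwist (unitExp v) y (n + a)‖ := by
          rw [← norm_mul, ← norm_mul]; exact norm_add_le _ _
      _ ≤ (|u| * omegaLarge y n) * 1 + 1 * (|v| * omegaLarge y (n + a)) := by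
          gcongr
          · exact norm_muTwist_le v _
          · exact norm_sqfTwist_le (norm_unitExp u) y n
      _ ≤ _ := by
          rw [mul_one, one_mul, add_zero]
          gcongr
          · exact le_max_left _ _
          · exact le_max_right _ _
  rw [← sum_sub_distrib]
  refine (norm_sum_le_of_le _ fun n _ => hpt n).trans ?_
  rw [sum_add_distrib, ← mul_sum, ← mul_sum, ← mul_add]
  have hw0 : 0 ≤ w := (abs_nonneg u).trans (le_max_left _ _)
  refine mul_le_mul_of_nonneg_left ?_ hw0
  refine (add_le_add (sum_omegaLarge_add_le y (Nat.zero_le N)) (sum_omegaLarge_add_le y ha)).trans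
    (le_of_eq ?_)
  push_cast
  ring

lemma norm_sum_muTwist_mul_le_self (u v : ℝ) (a : ℕ) {x : ℝ} (hx : 0 ≤ x) :
    ‖∑ n ∈ Icc 1 ⌊x⌋₊, muTwist u n * muTwist v (n + a)‖ ≤ x := by
  calc _ ≤ ∑ n ∈ Icc 1 ⌊x⌋₊, (1 : ℝ) := norm_sum_le_of_le _ fun n _ => by
        rw [norm_mul]
        exact mul_le_one₀ (norm_muTwist_le u n) (norm_nonneg _) (norm_muTwist_le v _)
    _ ≤ x := by simpa using Nat.floor_le hx

lemma cos_le_one_sub {u : ℝ} (hu : |u| ≤ 1) : Real.cos u ≤ 1 - 11 / 25 * u ^ 2 := by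
  have h1 := (abs_le.1 (Real.cos_bound hu)).2
  have h2 : |u| ^ 4 ≤ u ^ 2 := by
    have : |u| ^ 4 = u ^ 2 * u ^ 2 := by rw [← sq_abs u]; ring
    have h3 : u ^ 2 ≤ 1 := by rw [← sq_abs]; exact pow_le_one₀ (abs_nonneg u) hu
    nlinarith [sq_nonneg u]
  nlinarith [sq_nonneg u]

/-- The main range of the frequencies. -/
theorem norm_sum_muTwist_mul_le_of_small : ∃ C : ℝ, 0 < C ∧ ∀ a : ℕ, 1 ≤ a →
    ∀ᶠ x : ℝ in atTop, ∀ u v w : ℝ, w = max |u| |v| → w ≤ Real.exp (-1) →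
      1 ≤ w ^ 2 * Real.log (Real.log x) →
      ‖∑ n ∈ Icc 1 ⌊x⌋₊, muTwist u n * muTwist v (n + a)‖
        ≤ C * (x * (w * Real.log (1 / w) + Real.log x ^ (-(1 / 3) * (u ^ 2 + v ^ 2) : ℝ))) := by
  obtain ⟨C, hC, hcore⟩ := norm_sum_sqfTwist_mul_le_of_log_sqrt_le
  set b : ℝ := Real.exp 200 with hb
  have hb0 : 201 ≤ b := by linarith [Real.add_one_le_exp (200 : ℝ)]
  refine ⟨2 * C + 24 * (2 * (2 * (21 + b)) + 1), by positivity, fun a ha => ?_⟩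
  filter_upwards [hcore a ha, eventually_growth (max (4 * b) a)] with x hx hg u v w hw hw1 hwl
  obtain ⟨g1, g2, g3, g4, g5, g6⟩ := hg
  set L := Real.log x with hL
  set l := Real.log L with hl
  have hlb : 4 * b ≤ l := (le_max_left _ _).trans g1
  have hax : (a : ℝ) ≤ x := (le_max_right _ _).trans g5
  have hl0 : 0 < l := by linarith
  have hL0 : 0 < L := by linarith
  have hx0 : 0 < x := by linarith
  have hs : √L * √L = L := Real.mul_self_sqrt (by linarith)
  have hw0' : 0 ≤ w := by rw [hw]; exact (abs_nonneg u).trans (le_max_left _ _)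
  have hw0 : 0 < w := by
    rcases hw0'.eq_or_lt with h | h
    · rw [← h] at hwl; norm_num at hwl
    · exact h
  have hwone : w ≤ 1 := hw1.trans (by rw [Real.exp_le_one_iff]; norm_num)
  set t := Real.log (1 / w) with ht
  have ht' : t = -Real.log w := by rw [ht, one_div, Real.log_inv]
  have ht1 : 1 ≤ t := by
    have := Real.log_le_log hw0 hw1
    rw [Real.log_exp] at this
    linarith
  have hwt : w = Real.exp (-t) := by rw [ht', neg_neg, Real.exp_log hw0]
  have htl : t ≤ Real.log l / 2 := by
    have h1 : 1 / w ^ 2 ≤ l := by rw [div_le_iff₀ (by positivity)]; linarith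
    have h2 := Real.log_le_log (by positivity) h1
    rw [one_div, Real.log_inv, Real.log_pow] at h2
    push_cast at h2
    linarith
  set β := 21 * t + b with hβ
  have hβb : b ≤ β := by linarith
  have hβ0 : 0 < β := by linarith
  have hβl : β ≤ l := by linarith
  set y := Real.exp (L / β) with hy
  have hlogy : Real.log y = L / β := Real.log_exp _
  have hlogy0 : 0 < Real.log y := by rw [hlogy]; positivity
  have hβeq : β = Real.log x / Real.log y := by
    rw [hlogy, ← hL]; field_simp
  have hxy : √L ≤ Real.log y := by
    rw [hlogy, le_div_iff₀ hβ0]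
    calc _ ≤ √L * √L := by gcongr; linarith [Real.sqrt_nonneg L]
      _ = L := hs
  have haN : a ≤ ⌊x⌋₊ := Nat.le_floor hax
  have hNx : (⌊x⌋₊ : ℝ) ≤ x := Nat.floor_le hx0.le
  have hy1 : 1 < y := Real.one_lt_exp_iff.2 (by positivity)
  have hlogβ : Real.log β ≤ (21 + b) * t := by
    have h1 : β ≤ (21 + b) * t := by rw [hβ]; nlinarith
    exact (Real.log_le_self hβ0.le).trans h1
  have hlogβ1 : 1 ≤ Real.log β := by
    rw [Real.le_log_iff_exp_le hβ0]
    exact (Real.exp_le_exp.2 (by norm_num)).trans hβb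
  have htail : ∑ p ∈ primesIoc y (2 * ⌊x⌋₊ : ℕ), (1 : ℝ) / p
      ≤ 6 * ((2 * (2 * (21 + b)) + 1) * t) := by
    rcases lt_or_ge ((2 * ⌊x⌋₊ : ℕ) : ℝ) y with h | h
    · have : primesIoc y (2 * ⌊x⌋₊ : ℕ) = ∅ := by
        rw [eq_empty_iff_forall_notMem]
        intro p hp
        rw [mem_primesIoc (Nat.cast_nonneg _)] at hp
        linarith [hp.2.1, hp.2.2]
      rw [this, sum_empty]
      positivity
    · have h2 : Real.log ((2 * ⌊x⌋₊ : ℕ) : ℝ) ≤ 2 * β * Real.log y := by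
        calc _ ≤ Real.log (2 * x) := by
              refine Real.log_le_log (by linarith) ?_
              push_cast
              linarith
          _ = Real.log 2 + L := by rw [Real.log_mul (by norm_num) hx0.ne']
          _ ≤ 2 * L := by linarith [Real.log_le_sub_one_of_pos (show (0 : ℝ) < 2 by norm_num)]
          _ = _ := by rw [hlogy]; field_simp
      refine (sum_inv_primesIoc_le_log hy1 h h2).trans ?_
      have h3 : Real.log (2 * β) ≤ 2 * Real.log β := by
        rw [Real.log_mul (by norm_num) hβ0.ne']
        linarith [Real.log_le_sub_one_of_pos (show (0 : ℝ) < 2 by norm_num)]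
      linarith
  have hdiff := norm_sum_muTwist_sub_le u v y haN
  rw [← hw] at hdiff
  have hdiff2 : w * (4 * ⌊x⌋₊ * ∑ p ∈ primesIoc y (2 * ⌊x⌋₊ : ℕ), (1 : ℝ) / p)
      ≤ 24 * (2 * (2 * (21 + b)) + 1) * (x * (w * t)) := by
    calc _ ≤ w * (4 * x * (6 * ((2 * (2 * (21 + b)) + 1) * t))) := by gcongr
      _ = _ := by ring
  have key := hx (unitExp u) (unitExp v) y β (norm_unitExp u) (norm_unitExp v) (Real.exp_pos _)
    hβeq hβb hxy
  rw [unitExp_re, unitExp_re] at key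
  have hu1 : |u| ≤ 1 := (le_max_left |u| |v|).trans (by rw [← hw]; exact hwone)
  have hv1 : |v| ≤ 1 := (le_max_right |u| |v|).trans (by rw [← hw]; exact hwone)
  have hmainterm : Real.exp (-(2 - Real.cos u - Real.cos v) * (Real.log (Real.log y) - Real.log l))
      ≤ L ^ (-(1 / 3) * (u ^ 2 + v ^ 2) : ℝ) := by
    rw [Real.rpow_def_of_pos hL0, ← hl]
    refine Real.exp_le_exp.2 ?_
    have h1 := cos_le_one_sub hu1
    have h2 := cos_le_one_sub hv1
    have h3 : Real.log (Real.log y) = l - Real.log β := by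
      rw [hlogy, Real.log_div hL0.ne' hβ0.ne']
    have h4 : Real.log β ≤ Real.log l := Real.log_le_log hβ0 hβl
    have h5 : 7 / 8 * l ≤ Real.log (Real.log y) - Real.log l := by linarith
    have h6 : 11 / 25 * (u ^ 2 + v ^ 2) ≤ 2 - Real.cos u - Real.cos v := by linarith
    have h7 := mul_le_mul h6 h5 (by positivity) (le_trans (by positivity) h6)
    have h8 : 0 ≤ (u ^ 2 + v ^ 2) * l := by positivity
    linarith
  have hE : Real.exp (-(1 / 21) * β * Real.log β) ≤ w := by
    rw [hwt]
    refine Real.exp_le_exp.2 ?_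
    have : β * 1 ≤ β * Real.log β := by gcongr
    linarith
  have hl1 : 1 / l ≤ w := by
    rw [div_le_iff₀ hl0]
    calc 1 ≤ w ^ 2 * l := hwl
      _ ≤ w * l := by
        gcongr
        rw [sq]
        exact mul_le_of_le_one_left hw0' hwone
  have hwwt : w ≤ w * t := le_mul_of_one_le_right hw0' ht1
  have hfin := (norm_sub_norm_le _ _).trans hdiff
  set R := L ^ (-(1 / 3) * (u ^ 2 + v ^ 2) : ℝ) with hR
  have hR0 : 0 ≤ R := Real.rpow_nonneg hL0.le _
  have hkey2 : C * x * (Real.exp (-(2 - Real.cos u - Real.cos v) *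
      (Real.log (Real.log y) - Real.log l)) + Real.exp (-(1 / 21) * β * Real.log β) + 1 / l)
      ≤ 2 * C * (x * (w * t + R)) := by
    calc _ ≤ C * x * (R + w * t + w * t) := by
          gcongr
          · exact hE.trans hwwt
          · exact hl1.trans hwwt
      _ ≤ C * x * (2 * (w * t + R)) := by gcongr; linarith
      _ = _ := by ring
  have h9 : 24 * (2 * (2 * (21 + b)) + 1) * (x * (w * t))
      ≤ 24 * (2 * (2 * (21 + b)) + 1) * (x * (w * t + R)) := by
    gcongr; linarith
  linarith

theorem norm_sum_muTwist_mul_le : ∃ x₀ : ℝ, ∀ a : ℕ, 1 ≤ a → ∃ C : ℝ, 0 < C ∧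
    ∀ x u v w : ℝ, x₀ ≤ x → |u| ≤ 2 * Real.pi → |v| ≤ 2 * Real.pi → w = max |u| |v| →
      ‖∑ n ∈ Icc 1 ⌊x⌋₊, muTwist u n * muTwist v (n + a)‖
        ≤ C * (x * (w * max 1 (Real.log (1 / w)) +
            Real.log x ^ (-(1 / 3) * (u ^ 2 + v ^ 2) : ℝ))) := by
  obtain ⟨C, hC, hcore⟩ := norm_sum_muTwist_mul_le_of_small
  obtain ⟨x₀, hx₀⟩ := eventually_atTop.1 (eventually_growth 1)
  refine ⟨x₀, fun a ha => ?_⟩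
  obtain ⟨X, hX⟩ := eventually_atTop.1 (hcore a ha)
  refine ⟨C + Real.exp 1 + Real.exp (128 * |Real.log (Real.log X)|), by positivity, ?_⟩
  intro x u v w hx hu hv hw
  obtain ⟨g1, g2, g3, g4, g5, g6⟩ := hx₀ x hx
  have hL0 : 0 < Real.log x := by linarith
  have hx0 : 0 < x := by linarith
  have hw0 : 0 ≤ w := by rw [hw]; exact (abs_nonneg u).trans (le_max_left _ _)
  have hu2 : u ^ 2 ≤ w ^ 2 := by
    rw [← sq_abs u, hw]; gcongr; exact le_max_left _ _
  have hv2 : v ^ 2 ≤ w ^ 2 := by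
    rw [← sq_abs v, hw]; gcongr; exact le_max_right _ _
  have hw8 : w ≤ 8 := by
    rw [hw]
    have := Real.pi_lt_d2
    exact max_le (by linarith) (by linarith)
  have hwmax : 0 ≤ w * max 1 (Real.log (1 / w)) :=
    mul_nonneg hw0 (zero_le_one.trans (le_max_left _ _))
  have hwle : w ≤ w * max 1 (Real.log (1 / w)) :=
    le_mul_of_one_le_right hw0 (le_max_left _ _)
  have htriv := norm_sum_muTwist_mul_le_self u v a hx0.le
  set S := ‖∑ n ∈ Icc 1 ⌊x⌋₊, muTwist u n * muTwist v (n + a)‖ with hS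
  set M := w * max 1 (Real.log (1 / w)) with hM
  have hRdef : Real.log x ^ (-(1 / 3) * (u ^ 2 + v ^ 2) : ℝ)
      = Real.exp (Real.log (Real.log x) * (-(1 / 3) * (u ^ 2 + v ^ 2))) :=
    Real.rpow_def_of_pos hL0 _
  set R := Real.log x ^ (-(1 / 3) * (u ^ 2 + v ^ 2) : ℝ) with hR
  have hR0 : 0 ≤ R := Real.rpow_nonneg hL0.le _
  have c1 := Real.exp_pos 1
  have c2 := Real.exp_pos (128 * |Real.log (Real.log X)|)
  have hT : 0 ≤ x * (M + R) := by positivity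
  have trivial_case : ∀ c : ℝ, 0 ≤ c →
      c ≤ C + Real.exp 1 + Real.exp (128 * |Real.log (Real.log X)|) → 1 ≤ c * (M + R) →
      S ≤ (C + Real.exp 1 + Real.exp (128 * |Real.log (Real.log X)|)) * (x * (M + R)) := by
    intro c hc0 hc h1
    calc S ≤ x * 1 := by linarith
      _ ≤ x * (c * (M + R)) := by gcongr
      _ = c * (x * (M + R)) := by ring
      _ ≤ _ := by gcongr
  rcases lt_or_ge x X with hxX | hxX
  · refine trivial_case (Real.exp (128 * |Real.log (Real.log X)|)) c2.le (by linarith) ?_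
    have h1 : 1 ≤ Real.exp (128 * |Real.log (Real.log X)|) * R := by
      rw [hRdef, ← Real.exp_add]
      refine Real.one_le_exp ?_
      have h2 : Real.log (Real.log x) ≤ |Real.log (Real.log X)| :=
        (Real.log_le_log hL0 (Real.log_le_log hx0 hxX.le)).trans (le_abs_self _)
      have h3 : u ^ 2 + v ^ 2 ≤ 128 := by nlinarith
      have h4 : 0 ≤ u ^ 2 + v ^ 2 := by positivity
      have h5 := mul_le_mul h2 h3 h4 (abs_nonneg _)
      have h6 : 0 ≤ |Real.log (Real.log X)| := abs_nonneg _
      linarith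
    have h7 := mul_nonneg c2.le hwmax
    linarith
  rcases lt_or_ge (Real.exp (-1)) w with hwbig | hwsmall
  · refine trivial_case (Real.exp 1) c1.le (by linarith) ?_
    have h1 : 1 ≤ Real.exp 1 * M := by
      calc (1 : ℝ) = Real.exp 1 * Real.exp (-1) := by rw [← Real.exp_add]; simp
        _ ≤ _ := by gcongr; linarith
    have h7 := mul_nonneg c1.le hR0
    linarith
  rcases lt_or_ge (w ^ 2 * Real.log (Real.log x)) 1 with hwl | hwl
  · refine trivial_case (Real.exp 1) c1.le (by linarith) ?_
    have h1 : 1 ≤ Real.exp 1 * R := by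
      rw [hRdef, ← Real.exp_add]
      refine Real.one_le_exp ?_
      have h5 := mul_le_mul_of_nonneg_right (add_le_add hu2 hv2) (zero_le_one.trans g1)
      linarith
    have h7 := mul_nonneg c1.le hwmax
    linarith
  have key := hX x hxX u v w hw hwsmall hwl
  rw [← hS, ← hR] at key
  calc S ≤ _ := key
    _ ≤ C * (x * (M + R)) := by
        gcongr
        rw [hM]
        gcongr
        exact le_max_right _ _
    _ ≤ _ := by gcongr; linarith

end MoebiusCorrelation

end

theorem mainTheorem1 :
    (∃ x₀ : ℝ, ∀ a : ℕ, 1 ≤ a → ∃ C : ℝ, 0 < C ∧ ∀ x y β : ℝ, x₀ ≤ x → 2 ≤ y → y ≤ x →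
      β = Real.log x / Real.log y → β ≤ Real.exp (MoebiusCorrelation.B x) →
        |∑ n ∈ Finset.Icc 1 ⌊x⌋₊,
            ((MoebiusCorrelation.muTrunc y n * MoebiusCorrelation.muTrunc y (n + a) : ℤ) : ℝ)|
          ≤ C * (x * (1 / MoebiusCorrelation.iterLog 2 y
              + Real.exp (-(1 / 21) * β * Real.log β)))) ∧
    (∃ x₀ : ℝ, ∀ a : ℕ, 1 ≤ a → ∃ C : ℝ, 0 < C ∧ ∀ x u v w : ℝ, x₀ ≤ x →
      |u| ≤ 2 * Real.pi → |v| ≤ 2 * Real.pi → w = max |u| |v| →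
        ‖∑ n ∈ Finset.Icc 1 ⌊x⌋₊,
            MoebiusCorrelation.muTwist u n * MoebiusCorrelation.muTwist v (n + a)‖
          ≤ C * (x * (w * max 1 (Real.log (1 / w))
              + Real.log x ^ (-(1 / 3) * (u ^ 2 + v ^ 2) : ℝ)))) :=
  ⟨MoebiusCorrelation.abs_sum_muTrunc_mul_le, MoebiusCorrelation.norm_sum_muTwist_mul_le⟩
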